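/- Let $\alpha \ge 6$ be a real number. In the online metric Steiner tree problem, points $x_0, x_1, x_2, \ldots$ of a metric space $X$ arrive one at a time; on the arrival of $x_n$ the distances $d(x_i,x_n)$ for $i<n$ are revealed, and a spanning tree $T_n$ on the arrived points $\{0,1,\ldots,n\}$ has to be output, which may depend only on the distances revealed so far (and on $\alpha$). A swap replaces one edge of the current spanning tree by a non-edge so that the result is again a spanning tree. Then there is a deterministic online algorithm such that, for every metric space $X$, every arrival sequence and every $n \ge 0$: (i) $T_n$ is a spanning tree on $\{0,1,\ldots,n\}$ whose cost (the sum of the lengths of its edges) is at most $$C = \frac{2\alpha^5}{(\alpha-1)^2}$$ times the cost of an optimal Steiner tree for the terminals $x_0,\ldots,x_n$, i.e. the infimum of the costs of all finite trees whose vertices are points of $X$ and include all of $x_0,\ldots,x_n$ (further points of $X$ are allowed as vertices); (ii) upon the arrival of $x_{n+1}$, the tree $T_{n+1}$ is obtained from $T_n$ by adding one edge that joins the vertex $n+1$ to one of $0,\ldots,n$, followed by at most $K = 2\alpha^2$ swaps. -/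

import Mathlib

/-- The length of the (unordered) edge `e` when the vertices `v : V` sit at the points `p v` of a
metric space. -/
noncomputable def edgeLength {V X : Type*} [PseudoMetricSpace X] (p : V → X) : Sym2 V → ℝ :=
  Sym2.lift ⟨fun u v => dist (p u) (p v), fun u v => dist_comm (p u) (p v)⟩

open Classical in
/-- The cost of a graph on a finite vertex set: the sum of the lengths of its edges. -/
noncomputable def graphCost {V X : Type*} [Fintype V] [PseudoMetricSpace X] (p : V → X)
    (G : SimpleGraph V) : ℝ :=
  ∑ e ∈ G.edgeFinset, edgeLength p e

/-- The costs of all Steiner trees for a set `S` of terminals in the space `X`: finite trees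
whose vertices are points of `X`, among them all the terminals and possibly further points. -/
def steinerTreeCosts {X : Type*} [PseudoMetricSpace X] (S : Set X) : Set ℝ :=
  {c | ∃ (V : Finset X) (G : SimpleGraph V), S ⊆ (V : Set X) ∧ G.IsTree ∧
    graphCost (fun v : V => (v : X)) G = c}

/-- The cost of an optimal Steiner tree for the terminals `S` (for finite `S`, the set of costs is
bounded below by `0`, and it is nonempty as soon as `S` is). -/
noncomputable def steinerOpt {X : Type*} [PseudoMetricSpace X] (S : Set X) : ℝ :=
  sInf (steinerTreeCosts S)

/-- A deterministic online algorithm: after the arrival of the points `0, …, n` it outputs a graph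
on them, which is a function of the distances between these points only. -/
def OnlineAlgorithm : Type :=
  (n : ℕ) → (Fin (n + 1) → Fin (n + 1) → ℝ) → SimpleGraph (Fin (n + 1))

/-- The graph `T_n` that the algorithm `A` maintains after the points `x 0, …, x n` of the arrival
sequence `x` have been revealed. -/
def OnlineAlgorithm.output (A : OnlineAlgorithm) {X : Type*} [PseudoMetricSpace X] (x : ℕ → X)
    (n : ℕ) : SimpleGraph (Fin (n + 1)) :=
  A n (fun i j => dist (x i) (x j))

/-- Connect a newly arrived vertex by a single edge to the old vertex `u`. -/
def addLeaf {n : ℕ} (T : SimpleGraph (Fin (n + 1))) (u : Fin (n + 1)) :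
    SimpleGraph (Fin (n + 2)) :=
  T.map Fin.castSuccEmb ⊔ SimpleGraph.edge u.castSucc (Fin.last (n + 1))

/-- An edge swap: an edge `e` of the tree `T` is exchanged for a non-edge `f`, and the result is
again a (spanning) tree. -/
def IsSwap {V : Type*} (T T' : SimpleGraph V) : Prop :=
  T.IsTree ∧ T'.IsTree ∧
    ∃ e ∈ T.edgeSet, ∃ f, f ∉ T.edgeSet ∧ T'.edgeSet = insert f (T.edgeSet \ {e})

/-- `SwapsTo k T T'`: the graph `T'` is obtained from `T` by `k` successive swaps. -/
inductive SwapsTo {V : Type*} : ℕ → SimpleGraph V → SimpleGraph V → Prop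
  | refl (T : SimpleGraph V) : SwapsTo 0 T T
  | step {k : ℕ} {T T' T'' : SimpleGraph V} :
      SwapsTo k T T' → IsSwap T' T'' → SwapsTo (k + 1) T T''

/-! Everything is done with the ratio 6: its bounds, 72 swaps and the factor 288, imply the claimed
ones for every `α ≥ 6`. The algorithm joins a new point to a nearest old one, then makes up to 72
swaps, each removing a heaviest edge replaceable by one shorter than a sixth of it. The tree is
settled at `ρ` if, for every `r ≥ ρ`, its edges longer than `6 * r` are fewer than the clusters at
scale `r`.

The 72 rounds need not settle the tree, so fix `ρ` and let `s` be the last settled time up to `n`.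
The potential is the number of edges longer than `ρ * 6 ^ (j + 1)`, summed over `j`. After `s` every
round lowers it (`sum_numHeavy_iterate_improve`), and only arrivals far from all earlier points
raise it. A moat argument, with a geometric sum over the scales, shows that the old clusters and the
far arrivals together exceed the later clusters, one scale finer, by at most `12/5 * (n - s)`
(`sum_numClusters_add_card_isFar_le`). Since a spanning tree has at least one heavy edge fewer than
clusters, the two estimates telescope: `n - s` is less than the number of `ρ`-clusters at time `s`,
and so `numLong_le` bounds the long edges now by the clusters then.

For the cost, any Steiner tree crosses nested moats around clusters at all scales
(`sum_numClusters_le_graphCost`). The clusters may be taken at different times because `lastSettled`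
increases with the scale. Summing edge lengths by bands completes the comparison. -/

open Finset

/-! ### Forests, components and edge exchange -/

section Forest

variable {V : Type*}

/-- The subgraph of `G` consisting of the edges of weight at most `r`. -/
def lightPart (w : Sym2 V → ℝ) (r : ℝ) (G : SimpleGraph V) : SimpleGraph V where
  Adj u v := G.Adj u v ∧ w s(u, v) ≤ r
  symm := ⟨fun u v h => ⟨h.1.symm, by rw [Sym2.eq_swap]; exact h.2⟩⟩
  loopless := ⟨fun u h => G.loopless.irrefl u h.1⟩

theorem lightPart_le (w : Sym2 V → ℝ) (r : ℝ) (G : SimpleGraph V) : lightPart w r G ≤ G :=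
  fun _ _ h => h.1

theorem mem_edgeSet_lightPart {w : Sym2 V → ℝ} {r : ℝ} {G : SimpleGraph V} {e : Sym2 V} :
    e ∈ (lightPart w r G).edgeSet ↔ e ∈ G.edgeSet ∧ w e ≤ r := by
  induction e with | _ u v => exact Iff.rfl

/-- The number of connected components of the graph of the pairs of weight at most `r`. -/
noncomputable def numClusters (w : Sym2 V → ℝ) (r : ℝ) : ℕ :=
  Nat.card (lightPart w r ⊤).ConnectedComponent

open Classical in
/-- The number of edges of `G` of weight greater than `r`. -/
noncomputable def numHeavy [Fintype V] (w : Sym2 V → ℝ) (r : ℝ) (G : SimpleGraph V) : ℕ :=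
  #{e : Sym2 V | e ∈ G.edgeSet ∧ r < w e}

/-- The components of `G` other than that of `v` biject with those of the larger graph; `φ`, which
redirects the component of `v` to that of `u`, is invariant under the new adjacency and gives
injectivity. -/
theorem card_connectedComponent_sup_edge [Finite V] {G : SimpleGraph V} {u v : V}
    (h : ¬ G.Reachable u v) :
    Nat.card (G ⊔ SimpleGraph.edge u v).ConnectedComponent + 1 =
      Nat.card G.ConnectedComponent := by
  classical
  have := Fintype.ofFinite G.ConnectedComponent
  have huv : u ≠ v := fun e => h (e ▸ SimpleGraph.Reachable.refl _)
  have hle : G ≤ G ⊔ SimpleGraph.edge u v := le_sup_left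
  let φ : G.ConnectedComponent → G.ConnectedComponent := fun C =>
    if C = G.connectedComponentMk v then G.connectedComponentMk u else C
  have hφ : ∀ a b, (G ⊔ SimpleGraph.edge u v).Reachable a b →
      φ (G.connectedComponentMk a) = φ (G.connectedComponentMk b) := by
    rintro a b ⟨p⟩
    induction p with
    | nil => rfl
    | cons hadj _ ih =>
      rw [← ih]
      rcases hadj with hadj | hadj
      · rw [SimpleGraph.ConnectedComponent.eq.2 hadj.reachable]
      · rw [SimpleGraph.edge_adj] at hadj
        rcases hadj.1 with ⟨rfl, rfl⟩ | ⟨rfl, rfl⟩ <;>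
          simp [φ]
  let g : {C : G.ConnectedComponent // C ≠ G.connectedComponentMk v} →
      (G ⊔ SimpleGraph.edge u v).ConnectedComponent := fun C => C.1.map (.ofLE hle)
  have hg : Function.Bijective g := by
    constructor
    · rintro ⟨C, hC⟩ ⟨D, hD⟩ hCD
      induction C using SimpleGraph.ConnectedComponent.ind with | _ a =>
      induction D using SimpleGraph.ConnectedComponent.ind with | _ b =>
      have := hφ a b (SimpleGraph.ConnectedComponent.eq.1 hCD)
      simp only [φ, if_neg hC, if_neg hD] at this
      exact Subtype.ext this
    · intro C
      induction C using SimpleGraph.ConnectedComponent.ind with | _ a =>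
      by_cases ha : G.connectedComponentMk a = G.connectedComponentMk v
      · refine ⟨⟨G.connectedComponentMk u, fun e => h (SimpleGraph.ConnectedComponent.eq.1 e)⟩, ?_⟩
        refine SimpleGraph.ConnectedComponent.eq.2 ?_
        have h1 : (G ⊔ SimpleGraph.edge u v).Adj u v :=
          Or.inr ((SimpleGraph.edge_adj ..).2 ⟨Or.inl ⟨rfl, rfl⟩, huv⟩)
        exact h1.reachable.trans ((SimpleGraph.ConnectedComponent.eq.1 ha).symm.mono hle)
      · exact ⟨⟨_, ha⟩, rfl⟩
  rw [← Nat.card_congr (Equiv.ofBijective g hg), Nat.card_eq_fintype_card,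
    Nat.card_eq_fintype_card, Fintype.card_subtype_compl, Fintype.card_subtype_eq]
  have : 0 < Fintype.card G.ConnectedComponent :=
    Fintype.card_pos_iff.2 ⟨G.connectedComponentMk v⟩
  omega

theorem SimpleGraph.IsAcyclic.ncard_edgeSet_add [Finite V] {F : SimpleGraph V}
    (hF : F.IsAcyclic) : F.edgeSet.ncard + Nat.card F.ConnectedComponent = Nat.card V := by
  induction hn : F.edgeSet.ncard generalizing F with
  | zero =>
    rw [Set.ncard_eq_zero, SimpleGraph.edgeSet_eq_empty] at hn
    subst hn
    rw [zero_add]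
    symm
    refine Nat.card_congr (Equiv.ofBijective (⊥ : SimpleGraph V).connectedComponentMk ⟨?_, ?_⟩)
    · intro a b hab
      simpa using SimpleGraph.ConnectedComponent.eq.1 hab
    · exact fun C => C.exists_rep
  | succ k ih =>
    obtain ⟨e, he⟩ : F.edgeSet.Nonempty := by
      rw [← Set.ncard_pos]; omega
    have hb := SimpleGraph.isAcyclic_iff_forall_isBridge.1 hF he
    induction e with | _ u v =>
    rw [SimpleGraph.isBridge_iff] at hb
    have h1 := ih (F := F.deleteEdges {s(u, v)}) (hF.anti (SimpleGraph.deleteEdges_le _)) (by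
      rw [SimpleGraph.edgeSet_deleteEdges, Set.ncard_sdiff_singleton_of_mem he, hn]; rfl)
    have h2 := card_connectedComponent_sup_edge hb
    have h3 : F.deleteEdges {s(u, v)} ⊔ SimpleGraph.edge u v = F := by
      rw [← SimpleGraph.edgeSet_inj, SimpleGraph.edgeSet_sup, SimpleGraph.edgeSet_deleteEdges,
        SimpleGraph.edgeSet_edge_of_ne (SimpleGraph.Adj.ne he)]
      simpa using he
    rw [h3] at h2
    omega

theorem SimpleGraph.IsTree.numHeavy_add_one [Fintype V] {T : SimpleGraph V} (hT : T.IsTree)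
    (w : Sym2 V → ℝ) (r : ℝ) :
    numHeavy w r T + 1 = Nat.card (lightPart w r T).ConnectedComponent := by
  classical
  have h1 := (hT.isAcyclic.anti (lightPart_le w r T)).ncard_edgeSet_add
  have h2 := (SimpleGraph.isTree_iff_connected_and_card.1 hT).2
  have h3 : T.edgeSet.ncard = (lightPart w r T).edgeSet.ncard + numHeavy w r T := by
    rw [numHeavy, ← Set.ncard_coe_finset, ← Set.ncard_union_eq]
    · congr 1
      ext e
      simp only [Set.mem_union, mem_edgeSet_lightPart, coe_filter, mem_univ, true_and,
        Set.mem_ofPred_eq]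
      have := le_or_gt (w e) r
      tauto
    · rw [Set.disjoint_left]
      intro e h h'
      simp only [coe_filter, mem_univ, true_and, Set.mem_ofPred_eq] at h'
      exact absurd h'.2 (not_lt.2 (mem_edgeSet_lightPart.1 h).2)
  have h4 : Nat.card T.edgeSet = T.edgeSet.ncard := rfl
  omega

theorem card_connectedComponent_le_of_imp [Finite V] {G H : SimpleGraph V}
    (h : ∀ u v, G.Adj u v → H.Reachable u v) :
    Nat.card H.ConnectedComponent ≤ Nat.card G.ConnectedComponent := by
  have h' : ∀ u v, G.Reachable u v → H.Reachable u v := by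
    rintro u v ⟨p⟩
    induction p with
    | nil => exact .refl _
    | cons hadj _ ih => exact (h _ _ hadj).trans ih
  refine Nat.card_le_card_of_surjective (f := fun C : G.ConnectedComponent =>
    SimpleGraph.ConnectedComponent.lift H.connectedComponentMk
      (fun u v p _ => SimpleGraph.ConnectedComponent.eq.2 (h' u v p.reachable)) C) ?_
  intro C
  induction C using SimpleGraph.ConnectedComponent.ind with | _ a =>
  exact ⟨G.connectedComponentMk a, rfl⟩

theorem SimpleGraph.IsTree.numClusters_le [Fintype V] {T : SimpleGraph V} (hT : T.IsTree)
    (w : Sym2 V → ℝ) (r : ℝ) : numClusters w r ≤ numHeavy w r T + 1 := by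
  rw [hT.numHeavy_add_one]
  exact card_connectedComponent_le_of_imp fun u v h =>
    SimpleGraph.Adj.reachable (G := lightPart w r ⊤) ⟨h.1.ne, h.2⟩

/-- If the light pair `u v` is not joined in the light part of a tree, then it can be exchanged
for a heavy edge. -/
theorem SimpleGraph.IsTree.exists_swap [Finite V] {T : SimpleGraph V} (hT : T.IsTree)
    {w : Sym2 V → ℝ} {r : ℝ} {u v : V} (h : ¬ (lightPart w r T).Reachable u v) :
    ∃ e ∈ T.edgeSet, r < w e ∧ ∃ T' : SimpleGraph V, T'.IsTree ∧
      T'.edgeSet = insert s(u, v) (T.edgeSet \ {e}) := by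
  have huv : u ≠ v := fun e => h (e ▸ SimpleGraph.Reachable.refl _)
  obtain ⟨p, hp, hpu⟩ := hT.existsUnique_path u v
  obtain ⟨e, hep, hre⟩ : ∃ e ∈ p.edges, r < w e := by
    by_contra! hcon
    exact h ⟨p.transfer _ fun e he =>
      mem_edgeSet_lightPart.2 ⟨p.edges_subset_edgeSet he, hcon e he⟩⟩
  have heT := p.edges_subset_edgeSet hep
  have hnr : ¬ (T.deleteEdges {e}).Reachable u v := by
    intro hreach
    obtain ⟨q, hq⟩ := hreach.exists_isPath
    have := hpu (q.mapLe (T.deleteEdges_le {e})) (hq.mapLe _)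
    rw [← this, SimpleGraph.Walk.edges_mapLe_eq_edges] at hep
    have := q.edges_subset_edgeSet hep
    simp at this
  have hset : (T.deleteEdges {e} ⊔ SimpleGraph.edge u v).edgeSet
      = insert s(u, v) (T.edgeSet \ {e}) := by
    rw [SimpleGraph.edgeSet_sup, SimpleGraph.edgeSet_deleteEdges,
      SimpleGraph.edgeSet_edge_of_ne huv, Set.union_singleton]
  refine ⟨e, heT, hre, T.deleteEdges {e} ⊔ SimpleGraph.edge u v, ?_, hset⟩
  have hac : (T.deleteEdges {e} ⊔ SimpleGraph.edge u v).IsAcyclic :=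
    (hT.isAcyclic.anti (T.deleteEdges_le _)).sup_edge_of_not_reachable hnr
  have h1 := hac.ncard_edgeSet_add
  have h2 := (SimpleGraph.isTree_iff_connected_and_card.1 hT).2
  have h3 : s(u, v) ∉ T.edgeSet \ {e} := by
    intro hmem
    rw [← SimpleGraph.edgeSet_deleteEdges] at hmem
    exact hnr (SimpleGraph.Adj.reachable hmem)
  have h4 : (T.deleteEdges {e} ⊔ SimpleGraph.edge u v).edgeSet.ncard = T.edgeSet.ncard := by
    rw [hset, Set.ncard_insert_of_notMem h3, Set.ncard_sdiff_singleton_add_one heT]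
  have h5 : Nat.card T.edgeSet = T.edgeSet.ncard := rfl
  have hone : Nat.card (T.deleteEdges {e} ⊔ SimpleGraph.edge u v).ConnectedComponent = 1 := by
    omega
  have hsub := (Nat.card_eq_one_iff_unique.1 hone).1
  refine ⟨(SimpleGraph.connected_iff _).2 ⟨fun a b => ?_, ⟨u⟩⟩, hac⟩
  exact SimpleGraph.ConnectedComponent.eq.1 (Subsingleton.elim _ _)

open Classical in
/-- A minimum spanning tree joins any two vertices by edges no heavier than the pair itself. -/
theorem exists_isTree_forall_reachable [Fintype V] [Nonempty V] (w : Sym2 V → ℝ) :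
    ∃ T : SimpleGraph V, T.IsTree ∧ ∀ r u v, w s(u, v) ≤ r → (lightPart w r T).Reachable u v := by
  obtain ⟨T₀, -, hT₀⟩ := (SimpleGraph.connected_top (V := V)).exists_isTree_le
  obtain ⟨T, hT, hmin⟩ := Set.exists_min_image {T : SimpleGraph V | T.IsTree}
    (fun T => ∑ e : Sym2 V with e ∈ T.edgeSet, w e) (Set.toFinite _) ⟨T₀, hT₀⟩
  refine ⟨T, hT, fun r u v huv => ?_⟩
  by_contra hcon
  obtain ⟨e, he, hre, T', hT', hset⟩ := hT.exists_swap hcon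
  have hne : s(u, v) ∉ T.edgeSet := fun hmem =>
    hcon (SimpleGraph.Adj.reachable (G := lightPart w r T) ⟨hmem, huv⟩)
  have h1 := hmin T' hT'
  have h2 : ({e' : Sym2 V | e' ∈ T'.edgeSet} : Finset _)
      = insert s(u, v) (({e' : Sym2 V | e' ∈ T.edgeSet} : Finset _).erase e) := by
    ext e'
    simp [hset, and_comm]
  rw [h2, sum_insert (by simp [hne]), ← add_sum_erase _ _ (a := e) (by simpa using he)] at h1
  linarith

end Forest

/-! ### Local improvement and its potential -/

section Improvement

variable {V : Type*} [Fintype V]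

/-- At every scale `r ≥ ρ`, the graph `T` has no more edges longer than `6 * r` than a spanning
tree that joins the clusters at scale `r`. -/
def IsSettled (w : Sym2 V → ℝ) (ρ : ℝ) (T : SimpleGraph V) : Prop :=
  ∀ r, ρ ≤ r → numHeavy w (6 * r) T + 1 ≤ numClusters w r

theorem IsSettled.mono {w : Sym2 V → ℝ} {ρ ρ' : ℝ} {T : SimpleGraph V} (h : IsSettled w ρ T)
    (hρ : ρ ≤ ρ') : IsSettled w ρ' T := fun r hr => h r (hρ.trans hr)

theorem numHeavy_insert_le {w : Sym2 V → ℝ} {T T' : SimpleGraph V} {e f : Sym2 V}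
    (he : e ∈ T.edgeSet) (hset : T'.edgeSet = insert f (T.edgeSet \ {e})) (hfe : w f ≤ w e)
    (r : ℝ) : numHeavy w r T' ≤ numHeavy w r T := by
  classical
  by_cases hr : r < w f
  · refine (card_le_card (t := insert f ((univ.filter fun e => e ∈ T.edgeSet ∧ r < w e).erase e))
      fun e' => ?_).trans ((card_insert_le _ _).trans ?_)
    · simp only [hset, mem_filter, mem_univ, true_and, mem_insert, mem_erase, Set.mem_insert_iff,
        Set.mem_sdiff, Set.mem_singleton_iff]
      tauto
    · rw [card_erase_add_one]
      · exact le_rfl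
      · simpa using ⟨he, hr.trans_le hfe⟩
  · refine card_le_card fun e' => ?_
    simp only [hset, mem_filter, mem_univ, true_and, Set.mem_insert_iff,
      Set.mem_sdiff, Set.mem_singleton_iff]
    rintro ⟨rfl | h, h'⟩
    · exact absurd h' hr
    · exact ⟨h.1, h'⟩

theorem numHeavy_insert_add_one_le {w : Sym2 V → ℝ} {T T' : SimpleGraph V} {e f : Sym2 V} {r : ℝ}
    (he : e ∈ T.edgeSet) (hset : T'.edgeSet = insert f (T.edgeSet \ {e})) (hf : w f ≤ r)
    (hr : r < w e) : numHeavy w r T' + 1 ≤ numHeavy w r T := by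
  classical
  have hmem : e ∈ (univ.filter fun e => e ∈ T.edgeSet ∧ r < w e) := by simpa using ⟨he, hr⟩
  rw [numHeavy, numHeavy, ← card_erase_add_one hmem]
  gcongr
  intro e'
  simp only [hset, mem_filter, mem_univ, true_and, mem_erase, Set.mem_insert_iff,
      Set.mem_sdiff, Set.mem_singleton_iff]
  rintro ⟨rfl | h, h'⟩
  · exact absurd h' (not_lt.2 hf)
  · exact ⟨h.2, h.1, h'⟩

/-- `T'` arises from `T` by at most one swap that removes a heaviest edge among all those that can
be replaced by an edge of less than a sixth of their weight. -/
structure IsImprovement (w : Sym2 V → ℝ) (T T' : SimpleGraph V) : Prop where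
  isTree : T'.IsTree
  eq_or_isSwap : T' = T ∨ IsSwap T T'
  numHeavy_le (r : ℝ) : numHeavy w r T' ≤ numHeavy w r T
  progress (r : ℝ) (hr : 0 ≤ r) (h : ¬ numHeavy w (6 * r) T + 1 ≤ numClusters w r) :
    ∃ e, 6 * r < w e ∧ ∀ r', w e / 6 ≤ r' → r' < w e → numHeavy w r' T' + 1 ≤ numHeavy w r' T

theorem exists_isImprovement {w : Sym2 V → ℝ} (hw : ∀ e, 0 ≤ w e) {T : SimpleGraph V}
    (hT : T.IsTree) : ∃ T', IsImprovement w T T' := by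
  let P : Set (Sym2 V × Sym2 V) := {q | q.1 ∈ T.edgeSet ∧ q.2 ∉ T.edgeSet ∧ 6 * w q.2 < w q.1 ∧
    ∃ T' : SimpleGraph V, T'.IsTree ∧ T'.edgeSet = insert q.2 (T.edgeSet \ {q.1})}
  have hP : ∀ r, 0 ≤ r → ¬ numHeavy w (6 * r) T + 1 ≤ numClusters w r →
      ∃ q ∈ P, 6 * r < w q.1 := by
    intro r hr h
    rw [hT.numHeavy_add_one] at h
    have : ∃ u v, (lightPart w r ⊤).Adj u v ∧ ¬ (lightPart w (6 * r) T).Reachable u v := by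
      by_contra! hcon
      exact h (card_connectedComponent_le_of_imp hcon)
    obtain ⟨u, v, huv, hnr⟩ := this
    obtain ⟨e, he, hre, T', hT', hset⟩ := hT.exists_swap hnr
    have hle := huv.2
    refine ⟨(e, s(u, v)), ⟨he, fun hmem => hnr ?_, ?_, T', hT', hset⟩, hre⟩
    · exact SimpleGraph.Adj.reachable (G := lightPart w (6 * r) T) ⟨hmem, by linarith⟩
    · change 6 * w s(u, v) < w e
      linarith
  rcases P.eq_empty_or_nonempty with hempty | hne
  · refine ⟨T, hT, Or.inl rfl, fun _ => le_rfl, fun r hr h => ?_⟩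
    obtain ⟨q, hq, -⟩ := hP r hr h
    simp [hempty] at hq
  -- Maximality of the removed edge makes one swap serve every unsettled `r` at once: each of them
  -- supplies a candidate longer than `6 * r`.
  · obtain ⟨⟨e, f⟩, ⟨he, hf, hfe, T', hT', hset⟩, hmax⟩ :=
      Set.exists_max_image P (fun q => w q.1) (Set.toFinite _) hne
    have hf0 := hw f
    refine ⟨T', hT', Or.inr ⟨hT, hT', e, he, f, hf, hset⟩,
      numHeavy_insert_le he hset (by linarith), fun r hr h => ?_⟩
    obtain ⟨q, hq, hrq⟩ := hP r hr h
    refine ⟨e, hrq.trans_le (hmax q hq), fun r' h1 h2 => ?_⟩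
    exact numHeavy_insert_add_one_le he hset (by linarith) h2

open Classical in
/-- One round of local improvement. -/
noncomputable def improve (w : Sym2 V → ℝ) (T : SimpleGraph V) : SimpleGraph V :=
  if h : ∃ T', IsImprovement w T T' then h.choose else T

theorem isImprovement_improve {w : Sym2 V → ℝ} (hw : ∀ e, 0 ≤ w e) {T : SimpleGraph V}
    (hT : T.IsTree) : IsImprovement w T (improve w T) := by
  have h := exists_isImprovement hw hT
  rw [improve, dif_pos h]
  exact h.choose_spec

/-- Some threshold of the potential falls in `[M / 6, M)`, the window in which replacing an edge of
weight `M` is sure to be noticed. -/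
theorem exists_pow_lt_le {ρ M : ℝ} (hρ : 0 < ρ) (hM : 6 * ρ < M) {Q : ℕ} (hQ : M ≤ ρ * 6 ^ Q) :
    ∃ j < Q, ρ * 6 ^ (j + 1) < M ∧ M ≤ ρ * 6 ^ (j + 2) := by
  induction Q with
  | zero => rw [pow_zero] at hQ; linarith
  | succ Q ih =>
    by_cases h : M ≤ ρ * 6 ^ Q
    · obtain ⟨j, hj, h'⟩ := ih h
      exact ⟨j, by omega, h'⟩
    · cases Q with
      | zero => rw [zero_add, pow_one] at hQ; linarith
      | succ j => exact ⟨j, by omega, not_le.1 h, hQ⟩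

theorem isTree_iterate_improve {w : Sym2 V → ℝ} (hw : ∀ e, 0 ≤ w e) {T : SimpleGraph V}
    (hT : T.IsTree) (k : ℕ) : ((improve w)^[k] T).IsTree := by
  induction k with
  | zero => exact hT
  | succ k ih =>
    rw [Function.iterate_succ_apply']
    exact (isImprovement_improve hw ih).isTree

theorem swapsTo_iterate_improve {w : Sym2 V → ℝ} (hw : ∀ e, 0 ≤ w e) {T : SimpleGraph V}
    (hT : T.IsTree) (k : ℕ) : ∃ k' ≤ k, SwapsTo k' T ((improve w)^[k] T) := by
  induction k with
  | zero => exact ⟨0, le_rfl, .refl T⟩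
  | succ k ih =>
    obtain ⟨k', hk', hs⟩ := ih
    rw [Function.iterate_succ_apply']
    rcases (isImprovement_improve hw (isTree_iterate_improve hw hT k)).eq_or_isSwap with h | h
    · rw [h]
      exact ⟨k', by omega, hs⟩
    · exact ⟨k' + 1, by omega, .step hs h⟩

theorem numHeavy_iterate_improve_le {w : Sym2 V → ℝ} (hw : ∀ e, 0 ≤ w e) {T : SimpleGraph V}
    (hT : T.IsTree) (k : ℕ) (r : ℝ) : numHeavy w r ((improve w)^[k] T) ≤ numHeavy w r T := by
  induction k with
  | zero => exact le_rfl
  | succ k ih =>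
    rw [Function.iterate_succ_apply']
    exact ((isImprovement_improve hw (isTree_iterate_improve hw hT k)).numHeavy_le r).trans ih

/-- No round raises any heavy count, and a round on an unsettled tree lowers the count at one of the
thresholds. A tree unsettled at the end was unsettled before every round. -/
theorem sum_numHeavy_iterate_improve {w : Sym2 V → ℝ} (hw : ∀ e, 0 ≤ w e) {T : SimpleGraph V}
    (hT : T.IsTree) {ρ : ℝ} (hρ : 0 < ρ) {Q : ℕ} (hQ : ∀ e, w e ≤ ρ * 6 ^ Q) (k : ℕ)
    (h : ¬ IsSettled w ρ ((improve w)^[k] T)) :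
    ∑ j ∈ range Q, numHeavy w (ρ * 6 ^ (j + 1)) ((improve w)^[k] T) + k ≤
      ∑ j ∈ range Q, numHeavy w (ρ * 6 ^ (j + 1)) T := by
  induction k with
  | zero => exact le_rfl
  | succ k ih =>
    rw [Function.iterate_succ_apply'] at h ⊢
    have himp := isImprovement_improve hw (isTree_iterate_improve hw hT k)
    set T₁ := (improve w)^[k] T
    have hT₁ : ¬ IsSettled w ρ T₁ := fun hs => h fun r hr =>
      (Nat.add_le_add_right (himp.numHeavy_le _) 1).trans (hs r hr)
    refine le_trans ?_ (ih hT₁)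
    rw [IsSettled] at hT₁
    push Not at hT₁
    obtain ⟨r, hr, hlt⟩ := hT₁
    obtain ⟨e, hre, he⟩ := himp.progress r (hρ.le.trans hr) (not_le.2 hlt)
    obtain ⟨j, hj, h1, h2⟩ := exists_pow_lt_le hρ (M := w e) (by linarith) (hQ e)
    have h3 := he _ (by rw [pow_succ] at h2; linarith) h1
    have h4 : ∑ j ∈ range Q, numHeavy w (ρ * 6 ^ (j + 1)) (improve w T₁) + 1 ≤
        ∑ j ∈ range Q, numHeavy w (ρ * 6 ^ (j + 1)) T₁ :=
      Finset.sum_lt_sum (fun _ _ => himp.numHeavy_le _) ⟨j, mem_range.2 hj, h3⟩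
    omega

end Improvement

/-! ### Attaching a new vertex -/

section AddLeaf

variable {n : ℕ}

theorem edgeSet_addLeaf (T : SimpleGraph (Fin (n + 1))) (u : Fin (n + 1)) :
    (addLeaf T u).edgeSet =
      insert s(u.castSucc, Fin.last (n + 1)) (Sym2.map Fin.castSucc '' T.edgeSet) := by
  rw [addLeaf, SimpleGraph.edgeSet_sup, SimpleGraph.edgeSet_map,
    SimpleGraph.edgeSet_edge_of_ne (Fin.castSucc_lt_last u).ne, Set.union_singleton]
  rfl

theorem isTree_addLeaf {T : SimpleGraph (Fin (n + 1))} (hT : T.IsTree) (u : Fin (n + 1)) :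
    (addLeaf T u).IsTree := by
  rw [SimpleGraph.isTree_iff_connected_and_card] at hT ⊢
  constructor
  · have key : ∀ v, (addLeaf T u).Reachable u.castSucc v := by
      intro v
      induction v using Fin.lastCases with
      | last =>
        refine SimpleGraph.Adj.reachable ?_
        rw [← SimpleGraph.mem_edgeSet, edgeSet_addLeaf]
        exact Set.mem_insert _ _
      | cast v =>
        exact ((hT.1 u v).map (SimpleGraph.Embedding.map Fin.castSuccEmb T).toHom).mono
          le_sup_left
    exact (SimpleGraph.connected_iff _).2 ⟨fun a b => (key a).symm.trans (key b), inferInstance⟩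
  · have h1 : Nat.card (addLeaf T u).edgeSet = Nat.card T.edgeSet + 1 := by
      change Set.ncard _ = Set.ncard _ + 1
      rw [edgeSet_addLeaf, Set.ncard_insert_of_notMem,
        Set.ncard_image_of_injective _ (Sym2.map.injective (Fin.castSucc_injective _))]
      rintro ⟨e, -, he⟩
      have : Fin.last (n + 1) ∈ Sym2.map Fin.castSucc e := by rw [he]; simp
      obtain ⟨a, -, ha⟩ := Sym2.mem_map.1 this
      exact (Fin.castSucc_lt_last a).ne ha
    have h2 := hT.2
    simp only [Nat.card_eq_fintype_card, Fintype.card_fin] at h1 h2 ⊢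
    omega

open Classical in
theorem numHeavy_addLeaf_le (w : Sym2 (Fin (n + 2)) → ℝ) (T : SimpleGraph (Fin (n + 1)))
    (u : Fin (n + 1)) (r : ℝ) :
    numHeavy w r (addLeaf T u) ≤ numHeavy (fun e => w (e.map Fin.castSucc)) r T +
      if r < w s(u.castSucc, Fin.last (n + 1)) then 1 else 0 := by
  rw [numHeavy]
  refine (card_le_card (t := ((univ.filter fun e => e ∈ T.edgeSet ∧
    r < w (e.map Fin.castSucc)).image (Sym2.map Fin.castSucc)) ∪
    if r < w s(u.castSucc, Fin.last (n + 1)) then {s(u.castSucc, Fin.last (n + 1))} else ∅)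
      ?_).trans ((card_union_le _ _).trans (add_le_add card_image_le ?_))
  · intro e
    simp only [edgeSet_addLeaf, mem_filter, mem_univ, true_and, Set.mem_insert_iff, Set.mem_image,
      mem_union, mem_image]
    rintro ⟨rfl | ⟨e, he, rfl⟩, hr⟩
    · rw [if_pos hr]; simp
    · exact Or.inl ⟨e, ⟨he, hr⟩, rfl⟩
  · split_ifs <;> simp

end AddLeaf

/-! ### The online algorithm and its long edges -/

section Algorithm

/-- The weights on the pairs of vertices given by a distance matrix. -/
noncomputable def pairWeight {V : Type*} (D : V → V → ℝ) : Sym2 V → ℝ :=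
  Sym2.lift ⟨fun u v => max (D u v) (D v u), fun _ _ => max_comm _ _⟩

/-- An old vertex that is nearest to the new one. -/
noncomputable def nearest {n : ℕ} (D : Fin (n + 2) → Fin (n + 2) → ℝ) : Fin (n + 1) :=
  (Finite.exists_min fun i : Fin (n + 1) => D i.castSucc (Fin.last (n + 1))).choose

theorem nearest_le {n : ℕ} (D : Fin (n + 2) → Fin (n + 2) → ℝ) (i : Fin (n + 1)) :
    D (nearest D).castSucc (Fin.last (n + 1)) ≤ D i.castSucc (Fin.last (n + 1)) :=
  (Finite.exists_min fun i : Fin (n + 1) => D i.castSucc (Fin.last (n + 1))).choose_spec i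

/-- Connect each new vertex to a nearest old one, then perform `72` rounds of local improvement. -/
noncomputable def localSearchTree :
    (n : ℕ) → (Fin (n + 1) → Fin (n + 1) → ℝ) → SimpleGraph (Fin (n + 1))
  | 0, _ => ⊥
  | n + 1, D => (improve (pairWeight D))^[72]
      (addLeaf (localSearchTree n fun i j => D i.castSucc j.castSucc) (nearest D))

/-- Local search as an online algorithm. -/
noncomputable def localSearch : OnlineAlgorithm := localSearchTree

variable {X : Type*} [PseudoMetricSpace X]

/-- The lengths of the pairs of the points `x 0, …, x n`. -/
noncomputable def prefixLength (x : ℕ → X) (n : ℕ) : Sym2 (Fin (n + 1)) → ℝ :=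
  edgeLength fun i => x i

theorem edgeLength_mk {V : Type*} (p : V → X) (u v : V) :
    edgeLength p s(u, v) = dist (p u) (p v) := rfl

theorem prefixLength_mk (x : ℕ → X) (n : ℕ) (u v : Fin (n + 1)) :
    prefixLength x n s(u, v) = dist (x u) (x v) := rfl

theorem edgeLength_nonneg {V : Type*} (p : V → X) (e : Sym2 V) : 0 ≤ edgeLength p e := by
  induction e with | _ u v => exact dist_nonneg

theorem pairWeight_dist (x : ℕ → X) (n : ℕ) :
    pairWeight (fun i j : Fin (n + 1) => dist (x i) (x j)) = prefixLength x n := by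
  ext e
  induction e with | _ u v =>
  exact (congrArg _ (dist_comm _ _)).trans (max_self _)

theorem output_localSearch_succ (x : ℕ → X) (n : ℕ) :
    localSearch.output x (n + 1) = (improve (prefixLength x (n + 1)))^[72]
      (addLeaf (localSearch.output x n)
        (nearest fun i j : Fin (n + 2) => dist (x i) (x j))) := by
  rw [← pairWeight_dist]
  rfl

theorem isTree_output_localSearch (x : ℕ → X) (n : ℕ) : (localSearch.output x n).IsTree := by
  induction n with
  | zero =>
    have : Subsingleton (Fin (0 + 1)) := inferInstanceAs (Subsingleton (Fin 1))
    exact SimpleGraph.IsTree.of_subsingleton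
  | succ n ih =>
    rw [output_localSearch_succ]
    exact isTree_iterate_improve (edgeLength_nonneg _) (isTree_addLeaf ih _) _

theorem swapsTo_output_localSearch (x : ℕ → X) (n : ℕ) :
    ∃ (u : Fin (n + 1)), ∃ k ≤ 72,
      SwapsTo k (addLeaf (localSearch.output x n) u) (localSearch.output x (n + 1)) := by
  rw [output_localSearch_succ]
  exact ⟨_, swapsTo_iterate_improve (edgeLength_nonneg _)
    (isTree_addLeaf (isTree_output_localSearch x n) _) _⟩

/-- The number of edges longer than `r` in the tree after `n` arrivals. -/
noncomputable def numLong (x : ℕ → X) (n : ℕ) (r : ℝ) : ℕ :=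
  numHeavy (prefixLength x n) r (localSearch.output x n)

/-- The point `x a` is farther than `r` from all the earlier ones. -/
def IsFar (x : ℕ → X) (r : ℝ) (a : ℕ) : Prop := ∀ i < a, r < dist (x i) (x a)

open Classical in
-- The new edge realizes the distance to the old points, so it is longer than `r` only if every old
-- point is.
theorem numHeavy_addLeaf_nearest_le (x : ℕ → X) (n : ℕ) (r : ℝ) :
    numHeavy (prefixLength x (n + 1)) r (addLeaf (localSearch.output x n)
        (nearest fun i j : Fin (n + 2) => dist (x i) (x j))) ≤
      numLong x n r + if IsFar x r (n + 1) then 1 else 0 := by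
  refine (numHeavy_addLeaf_le ..).trans (add_le_add (le_of_eq ?_) ?_)
  · rw [numLong]
    congr 1
    ext e
    induction e with | _ u v => rfl
  · by_cases h : IsFar x r (n + 1)
    · rw [if_pos h]
      split_ifs <;> simp
    · rw [if_neg h, if_neg]
      intro hlt
      rw [prefixLength_mk] at hlt
      refine h fun i hi => hlt.trans_le ?_
      exact nearest_le (fun i j : Fin (n + 2) => dist (x i) (x j)) ⟨i, hi⟩

open Classical in
theorem numLong_succ_le (x : ℕ → X) (n : ℕ) (r : ℝ) :
    numLong x (n + 1) r ≤ numLong x n r + if IsFar x r (n + 1) then 1 else 0 := by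
  refine le_trans ?_ (numHeavy_addLeaf_nearest_le x n r)
  rw [numLong, output_localSearch_succ]
  exact numHeavy_iterate_improve_le (edgeLength_nonneg _)
    (isTree_addLeaf (isTree_output_localSearch x n) _) _ _

open Classical in
theorem sum_numLong_succ_le (x : ℕ → X) (n : ℕ) {ρ : ℝ} (hρ : 0 < ρ) {Q : ℕ}
    (hQ : ∀ e, prefixLength x (n + 1) e ≤ ρ * 6 ^ Q)
    (h : ¬ IsSettled (prefixLength x (n + 1)) ρ (localSearch.output x (n + 1))) :
    ∑ j ∈ range Q, numLong x (n + 1) (ρ * 6 ^ (j + 1)) + 72 ≤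
      ∑ j ∈ range Q, (numLong x n (ρ * 6 ^ (j + 1)) +
        if IsFar x (ρ * 6 ^ (j + 1)) (n + 1) then 1 else 0) := by
  refine le_trans ?_ (sum_le_sum fun j _ => numHeavy_addLeaf_nearest_le x n _)
  rw [output_localSearch_succ] at h
  refine le_trans (le_of_eq ?_) (sum_numHeavy_iterate_improve (edgeLength_nonneg _)
    (isTree_addLeaf (isTree_output_localSearch x n) _) hρ hQ 72 h)
  simp_rw [numLong, output_localSearch_succ]
  rfl

end Algorithm

/-! ### Total variation of potentials along a graph -/

section Variation

variable {V X : Type*} [PseudoMetricSpace X]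

theorem dist_le_sum_edges (p : V → X) {G : SimpleGraph V} {a b : V}
    (q : G.Walk a b) : dist (p a) (p b) ≤ (q.edges.map (edgeLength p)).sum := by
  induction q with
  | nil => simp
  | cons h q ih =>
    rw [SimpleGraph.Walk.edges_cons, List.map_cons, List.sum_cons, edgeLength_mk]
    exact (dist_triangle _ _ _).trans (by gcongr)

theorem graphCost_nonneg [Fintype V] (p : V → X) (G : SimpleGraph V) : 0 ≤ graphCost p G :=
  sum_nonneg fun e _ => edgeLength_nonneg p e

/-- Applied later with real-valued `p`: the graph cost is then the total variation of a potential,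
and connecting two level sets costs at least their difference. -/
theorem dist_le_graphCost [Fintype V] (p : V → X) {G : SimpleGraph V}
    {a b : V} (h : G.Reachable a b) : dist (p a) (p b) ≤ graphCost p G := by
  classical
  obtain ⟨q, hq⟩ := h.exists_isPath
  refine (dist_le_sum_edges p q).trans ?_
  rw [← List.sum_toFinset _ hq.isTrail.edges_nodup]
  refine sum_le_sum_of_subset_of_nonneg (fun e he => ?_) fun e _ _ => edgeLength_nonneg p e
  rw [SimpleGraph.mem_edgeFinset]
  exact q.edges_subset_edgeSet (List.mem_toFinset.1 he)

theorem sum_graphCost_le [Fintype V] {ι : Type*} (s : Finset ι) (p : V → X) (h : ι → V → ℝ) {C : ℝ}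
    (hC : ∀ u v, ∑ k ∈ s, dist (h k u) (h k v) ≤ C * dist (p u) (p v)) (G : SimpleGraph V) :
    ∑ k ∈ s, graphCost (h k) G ≤ C * graphCost p G := by
  simp_rw [graphCost]
  rw [sum_comm, mul_sum]
  refine sum_le_sum fun e _ => ?_
  induction e with | _ u v => exact hC u v

theorem sum_le_of_subsingleton_support {ι : Type*} {s : Finset ι} {f : ι → ℝ} {L : ℝ} (hL : 0 ≤ L)
    (hf : ∀ k ∈ s, f k ≤ L) (huniq : ∀ k ∈ s, ∀ k' ∈ s, f k ≠ 0 → f k' ≠ 0 → k = k') :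
    ∑ k ∈ s, f k ≤ L := by
  by_cases h : ∃ k ∈ s, f k ≠ 0
  · obtain ⟨k, hk, hk0⟩ := h
    rw [sum_eq_single_of_mem k hk fun k' hk' hne => ?_]
    · exact hf k hk
    · by_contra h0
      exact hne (huniq k' hk' k hk h0 hk0)
  · push Not at h
    rwa [sum_eq_zero h]

theorem eq_of_infDist_lt {ι : Type*} {A : ι → Set X} {D : ℝ} (hne : ∀ k, (A k).Nonempty)
    (hsep : ∀ k k', k ≠ k' → ∀ a ∈ A k, ∀ b ∈ A k', D ≤ dist a b) {y : X} {k k' : ι}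
    (hk : Metric.infDist y (A k) < D / 2) (hk' : Metric.infDist y (A k') < D / 2) : k = k' := by
  by_contra h
  obtain ⟨a, ha, hya⟩ := (Metric.infDist_lt_iff (hne k)).1 hk
  obtain ⟨b, hb, hyb⟩ := (Metric.infDist_lt_iff (hne k')).1 hk'
  have := hsep k k' h a ha b hb
  have := dist_triangle_left a b y
  linarith

/-- The moats of width `D / 2` around sets `D` apart are disjoint. A truncated distance can rise
from `x` to `y` only if `x` is in its moat, so only one rises; rises in the two directions give the
factor 2. -/
theorem sum_dist_min_infDist_le {ι : Type*} (s : Finset ι) {A : ι → Set X} {D : ℝ}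
    (hne : ∀ k, (A k).Nonempty)
    (hsep : ∀ k k', k ≠ k' → ∀ a ∈ A k, ∀ b ∈ A k', D ≤ dist a b) (x y : X) :
    ∑ k ∈ s, dist (min (Metric.infDist x (A k)) (D / 2)) (min (Metric.infDist y (A k)) (D / 2)) ≤
      2 * dist x y := by
  have key : ∀ x y : X, ∑ k ∈ s, max (min (Metric.infDist y (A k)) (D / 2) -
      min (Metric.infDist x (A k)) (D / 2)) 0 ≤ dist x y := by
    intro x y
    refine sum_le_of_subsingleton_support dist_nonneg (fun k _ => max_le ?_ dist_nonneg) ?_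
    · have h1 : Metric.infDist y (A k) ≤ Metric.infDist x (A k) + dist y x :=
        Metric.infDist_le_infDist_add_dist
      have h2 := dist_nonneg (x := x) (y := y)
      rw [dist_comm] at h1
      rw [sub_le_iff_le_add, add_comm, ← min_add_add_right]
      exact min_le_min h1 (by linarith)
    · have h : ∀ k, max (min (Metric.infDist y (A k)) (D / 2) -
          min (Metric.infDist x (A k)) (D / 2)) 0 ≠ 0 → Metric.infDist x (A k) < D / 2 := by
        intro k hk
        by_contra! hcon
        refine hk (max_eq_right ?_)
        rw [min_eq_right hcon]
        linarith [min_le_right (Metric.infDist y (A k)) (D / 2)]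
      exact fun k _ k' _ hk hk' => eq_of_infDist_lt hne hsep (h k hk) (h k' hk')
  have h1 := key x y
  have h2 := key y x
  rw [dist_comm y x] at h2
  calc _ ≤ ∑ k ∈ s, (max (min (Metric.infDist y (A k)) (D / 2) -
      min (Metric.infDist x (A k)) (D / 2)) 0 + max (min (Metric.infDist x (A k)) (D / 2) -
      min (Metric.infDist y (A k)) (D / 2)) 0) := by
        refine sum_le_sum fun k _ => ?_
        rw [Real.dist_eq, abs_le']
        set a := min (Metric.infDist x (A k)) (D / 2)
        set b := min (Metric.infDist y (A k)) (D / 2)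
        have := le_max_left (a - b) 0
        have := le_max_right (a - b) 0
        have := le_max_left (b - a) 0
        have := le_max_right (b - a) 0
        constructor <;> linarith
    _ ≤ _ := by rw [sum_add_distrib]; linarith

end Variation

/-! ### Counting separated pieces by moats -/

section Counting

variable {V X : Type*} [Fintype V] [PseudoMetricSpace X]

/-- Two pieces that are far apart but lie in the same cluster at scale `r` force the connecting
forest `F` to cross a wide moat. -/
theorem le_graphCost_of_reachable (p : V → X) {S A : Set V} {F : SimpleGraph V} {r : ℝ}
    (hr : 0 < r) (hS : ∀ a ∈ A, ∀ s ∈ S, s ∉ A → 6 * r ≤ dist (p a) (p s))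
    (hF : ∀ u v, dist (p u) (p v) ≤ r →
      (F ⊔ SimpleGraph.fromRel fun u v => u ∈ S ∧ v ∈ S).Reachable u v)
    {a b : V} (ha : a ∈ A) (hb : ∀ a ∈ A, 6 * r ≤ dist (p a) (p b))
    (hab : (lightPart (edgeLength p) r ⊤).Reachable a b) :
    r ≤ graphCost (fun v => min (Metric.infDist (p v) (p '' A)) (6 * r / 2)) F := by
  set h : V → ℝ := fun v => min (Metric.infDist (p v) (p '' A)) (6 * r / 2) with hh
  have hfar : ∀ v, (∀ a ∈ A, 6 * r ≤ dist (p a) (p v)) → h v = 3 * r := by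
    intro v hv
    have : 6 * r ≤ Metric.infDist (p v) (p '' A) := by
      rw [Metric.le_infDist ⟨_, Set.mem_image_of_mem _ ha⟩]
      rintro _ ⟨a, ha, rfl⟩
      rw [dist_comm]
      exact hv a ha
    rw [hh]
    simp only
    rw [min_eq_right (by linarith)]
    ring
  have hzero : ∀ a ∈ A, h a ≤ 0 := fun a ha =>
    (min_le_left _ _).trans (Metric.infDist_zero_of_mem (Set.mem_image_of_mem _ ha)).le
  by_contra! hcon
  have hvar : ∀ u v, F.Reachable u v → h v < h u + r := by
    intro u v huv
    have h1 := dist_le_graphCost h huv.symm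
    have := le_abs_self (h v - h u)
    rw [Real.dist_eq] at h1
    linarith
  -- If the variation were below `r`, the part `Z` that `F` joins to `A` would stay below height
  -- `r`. A path of short pairs from `a` to `b` leaves `Z` at some `z` of height below `2 * r`.
  let Z : Set V := {z | ∃ a ∈ A, F.Reachable a z}
  have hZ : ∀ z ∈ Z, h z < r := by
    rintro z ⟨a, ha, haz⟩
    linarith [hvar a z haz, hzero a ha]
  have hbZ : b ∉ Z := fun hbZ => by linarith [hZ b hbZ, hfar b hb]
  obtain ⟨q⟩ := hab
  obtain ⟨d, -, hd1, hd2⟩ := q.exists_boundary_dart Z ⟨a, ha, .refl _⟩ hbZ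
  set y := d.fst
  set z := d.snd
  have hyz : dist (p y) (p z) ≤ r := d.adj.2
  have hz : h z < 2 * r := by
    have h1 := hZ y hd1
    have h2 : Metric.infDist (p z) (p '' A) ≤ Metric.infDist (p y) (p '' A) + dist (p z) (p y) :=
      Metric.infDist_le_infDist_add_dist
    rw [dist_comm] at h2
    have h3 : h z ≤ Metric.infDist (p z) (p '' A) := min_le_left _ _
    rcases min_lt_iff.1 h1 with h1 | h1 <;> linarith
  -- To get from `z` back to `y`, one must leave the `F`-component of `z` through a point of `S`. In
  -- `A` it would put `z` into `Z`; outside `A` it has height `3 * r`, too high for a component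
  -- containing `z`.
  obtain ⟨q'⟩ := hF z y (by rwa [dist_comm])
  obtain ⟨d', -, h1, h2⟩ := q'.exists_boundary_dart {v | F.Reachable z v} (.refl _) (by
    rintro hzy
    obtain ⟨a, ha, hay⟩ := hd1
    exact hd2 ⟨a, ha, hay.trans hzy.symm⟩)
  have h1' : F.Reachable z d'.fst := h1
  rcases d'.adj with hadj | hadj
  · exact h2 (h1'.trans hadj.reachable)
  · rw [SimpleGraph.fromRel_adj] at hadj
    have hS' : d'.fst ∈ S := by tauto
    by_cases hA : d'.fst ∈ A
    · exact hd2 ⟨_, hA, h1'.symm⟩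
    · have h3 := hfar d'.fst fun a ha => hS a ha _ hS' hA
      linarith [hvar z d'.fst h1']

/-- Pieces whose representative shares its cluster with no other inject into the clusters. Each
remaining piece forces `F` to vary by `r` in its own moat, and all these variations together are at
most twice the cost of `F`. -/
theorem card_le_of_separated {ι : Type*} [Fintype ι] (p : V → X) {S : Set V} {F : SimpleGraph V}
    {r : ℝ} (hr : 0 < r) {A : ι → Set V} (hne : ∀ k, (A k).Nonempty)
    (hsep : ∀ k k', k ≠ k' → ∀ a ∈ A k, ∀ b ∈ A k', 6 * r ≤ dist (p a) (p b))
    (hS : ∀ k, ∀ a ∈ A k, ∀ s ∈ S, s ∉ A k → 6 * r ≤ dist (p a) (p s))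
    (hF : ∀ u v, dist (p u) (p v) ≤ r →
      (F ⊔ SimpleGraph.fromRel fun u v => u ∈ S ∧ v ∈ S).Reachable u v) :
    (Fintype.card ι : ℝ) ≤ numClusters (edgeLength p) r + 2 / r * graphCost p F := by
  classical
  have := Fintype.ofFinite (lightPart (edgeLength p) r ⊤).ConnectedComponent
  choose a ha using hne
  let c : ι → (lightPart (edgeLength p) r ⊤).ConnectedComponent := fun k =>
    SimpleGraph.connectedComponentMk _ (a k)
  let N : Finset ι := {k | ∃ k', k ≠ k' ∧ c k = c k'}
  have h1 : #Nᶜ ≤ numClusters (edgeLength p) r := by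
    rw [numClusters, Nat.card_eq_fintype_card, ← card_univ]
    refine card_le_card_of_injOn c (fun _ _ => mem_univ _) fun k hk k' _ h => ?_
    by_contra hne
    simp only [N, coe_compl, coe_filter, mem_univ, true_and, Set.mem_compl_iff,
      Set.mem_ofPred_eq] at hk
    exact hk ⟨k', hne, h⟩
  have h2 : ∀ k ∈ N,
      r ≤ graphCost (fun v => min (Metric.infDist (p v) (p '' A k)) (6 * r / 2)) F := by
    intro k hk
    obtain ⟨k', hkk', hc⟩ := (mem_filter.1 hk).2
    exact le_graphCost_of_reachable p hr (hS k) hF (ha k) (fun b hb => hsep k k' hkk' b hb _ (ha k'))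
      (SimpleGraph.ConnectedComponent.eq.1 hc)
  have h3 : ∑ k ∈ N, graphCost (fun v => min (Metric.infDist (p v) (p '' A k)) (6 * r / 2)) F ≤
      2 * graphCost p F := by
    refine sum_graphCost_le N p _ (fun u v => sum_dist_min_infDist_le N
      (fun k => ⟨_, Set.mem_image_of_mem p (ha k)⟩) ?_ _ _) F
    rintro k k' hkk' _ ⟨b, hb, rfl⟩ _ ⟨b', hb', rfl⟩
    exact hsep k k' hkk' b hb b' hb'
  have h4 : #N * r ≤ 2 * graphCost p F := by
    rw [← nsmul_eq_mul]
    exact (card_nsmul_le_sum _ _ _ h2).trans h3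
  have h5 : (#N : ℝ) ≤ 2 / r * graphCost p F := by
    rw [div_mul_eq_mul_div, le_div_iff₀ hr]
    exact h4
  have h6 : (Fintype.card ι : ℝ) = #Nᶜ + #N := by
    rw [← card_compl_add_card N]; push_cast; rfl
  have h7 : (#Nᶜ : ℝ) ≤ numClusters (edgeLength p) r := by exact_mod_cast h1
  linarith

/-- The `min` on the right is what lets the induction pass from `a / 6` to `a`. -/
theorem sum_geometric_le {a : ℝ} (ha : 0 ≤ a) (Q : ℕ) :
    ∑ j ∈ range Q, (if a / 6 ^ j ≤ 1 then a / 6 ^ j else 0) ≤ 6 / 5 * min 1 a := by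
  induction Q generalizing a with
  | zero =>
    rw [range_zero, sum_empty]
    positivity
  | succ Q ih =>
    have h := ih (a := a / 6) (by positivity)
    have h0 : ∀ j : ℕ, a / 6 ^ (j + 1) = a / 6 / 6 ^ j := fun j => by rw [pow_succ']; field_simp
    rw [sum_range_succ']
    simp_rw [h0]
    rw [pow_zero, div_one]
    have := min_le_left 1 (a / 6)
    have := min_le_right 1 (a / 6)
    split_ifs with h1
    · rw [min_eq_right h1]
      linarith
    · rw [min_eq_left (by linarith)]
      linarith

end Counting

/-! ### How clusters change under arrivals -/

section Growth

variable {X : Type*} [PseudoMetricSpace X]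

/-- The graph that joins the old points to each other and the new ones in an optimal way: apart from
the edges between old points, it is a forest with at most `n - s` edges. -/
theorem exists_connecting_edges (x : ℕ → X) {s n : ℕ} (hs : s ≤ n) :
    ∃ H : Finset (Sym2 (Fin (n + 1))), #H ≤ n - s ∧ ∀ r, 0 ≤ r → ∃ F : SimpleGraph (Fin (n + 1)),
      (∀ e ∈ F.edgeSet, e ∈ H ∧ prefixLength x n e ≤ r) ∧
      ∀ u v : Fin (n + 1), dist (x u) (x v) ≤ r →
        (F ⊔ SimpleGraph.fromRel fun u v : Fin (n + 1) => (u : ℕ) ≤ s ∧ (v : ℕ) ≤ s).Reachable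
          u v := by
  classical
  -- Old pairs get a weight below every distance, so a minimum spanning tree joins the old points
  -- first. One tree then serves all scales.
  let w : Sym2 (Fin (n + 1)) → ℝ := fun e =>
    if ∀ v ∈ e, (v : ℕ) ≤ s then -1 else prefixLength x n e
  have hw : ∀ u v : Fin (n + 1), w s(u, v) =
      if (u : ℕ) ≤ s ∧ (v : ℕ) ≤ s then -1 else dist (x u) (x v) := by
    intro u v
    simp only [w, Sym2.mem_iff, forall_eq_or_imp, forall_eq]
    rfl
  obtain ⟨T, hT, hreach⟩ := exists_isTree_forall_reachable w
  refine ⟨({e | e ∈ T.edgeSet ∧ -1 < w e} : Finset _), ?_, fun r hr => ?_⟩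
  · have h1 := hT.numHeavy_add_one w (-1)
    -- At weight `-1` the old points form one component, represented by `s`; each of the `n - s` new
    -- points adds at most one.
    have h2 : Nat.card (lightPart w (-1) T).ConnectedComponent ≤ Nat.card (Fin (n - s + 1)) := by
      refine Nat.card_le_card_of_surjective (fun i : Fin (n - s + 1) =>
        SimpleGraph.connectedComponentMk _ (⟨s + i, by omega⟩ : Fin (n + 1))) fun C => ?_
      induction C using SimpleGraph.ConnectedComponent.ind with | _ v =>
      by_cases hv : (v : ℕ) ≤ s
      · refine ⟨0, SimpleGraph.ConnectedComponent.eq.2 (hreach _ _ _ ?_)⟩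
        rw [hw, if_pos ⟨by simp, hv⟩]
      · refine ⟨⟨v - s, by omega⟩, congrArg _ (Fin.ext ?_)⟩
        simp only
        omega
    rw [Nat.card_eq_fintype_card (α := Fin _), Fintype.card_fin, ← h1] at h2
    exact Nat.le_of_succ_le_succ h2
  · refine ⟨{ Adj := fun u v => T.Adj u v ∧ ¬ ((u : ℕ) ≤ s ∧ (v : ℕ) ≤ s) ∧ dist (x u) (x v) ≤ r
              symm := ⟨fun u v h => ⟨h.1.symm, fun h' => h.2.1 h'.symm, by
                rw [dist_comm]; exact h.2.2⟩⟩
              loopless := ⟨fun u h => T.loopless.irrefl u h.1⟩ }, fun e he => ?_, fun u v huv => ?_⟩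
    · induction e with | _ u v =>
      obtain ⟨h1, h2, h3⟩ : T.Adj u v ∧ ¬ ((u : ℕ) ≤ s ∧ (v : ℕ) ≤ s) ∧ dist (x u) (x v) ≤ r := he
      refine ⟨mem_filter.2 ⟨mem_univ _, h1, ?_⟩, h3⟩
      rw [hw, if_neg h2]
      linarith [dist_nonneg (x := x u) (y := x v)]
    · have h1 := hreach r u v (by
        rw [hw]
        split_ifs <;> linarith)
      refine h1.mono fun a b hab => ?_
      by_cases hS : (a : ℕ) ≤ s ∧ (b : ℕ) ≤ s
      · exact Or.inr ((SimpleGraph.fromRel_adj ..).2 ⟨hab.1.ne, Or.inl hS⟩)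
      · have h2 := hab.2
        rw [hw, if_neg hS] at h2
        exact Or.inl ⟨hab.1, hS, h2⟩

theorem le_dist_of_connectedComponentMk_ne (x : ℕ → X) {s : ℕ} {r : ℝ} {i j : Fin (s + 1)}
    (h : (lightPart (prefixLength x s) r ⊤).connectedComponentMk i ≠
      (lightPart (prefixLength x s) r ⊤).connectedComponentMk j) : r ≤ dist (x i) (x j) := by
  by_contra! hlt
  refine h (SimpleGraph.ConnectedComponent.eq.2 (SimpleGraph.Adj.reachable ⟨?_, hlt.le⟩))
  exact fun heq => h (congrArg _ heq)

open Classical in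
-- The old clusters at scale `6 * r` and the far arrivals, as singletons, are pieces to which
-- `card_le_of_separated` applies.
theorem numClusters_add_card_isFar_le (x : ℕ → X) {s n : ℕ} (hs : s ≤ n) {r : ℝ} (hr : 0 < r)
    {F : SimpleGraph (Fin (n + 1))}
    (hF : ∀ u v : Fin (n + 1), dist (x u) (x v) ≤ r →
        (F ⊔ SimpleGraph.fromRel fun u v : Fin (n + 1) => (u : ℕ) ≤ s ∧ (v : ℕ) ≤ s).Reachable
          u v) :
    (numClusters (prefixLength x s) (6 * r) : ℝ) + #{a ∈ Ioc s n | IsFar x (6 * r) a} ≤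
      numClusters (prefixLength x n) r + 2 / r * graphCost (fun i : Fin (n + 1) => x i) F := by
  let G : SimpleGraph (Fin (s + 1)) := lightPart (prefixLength x s) (6 * r) ⊤
  have := Fintype.ofFinite G.ConnectedComponent
  let A : G.ConnectedComponent ⊕ {a // a ∈ ({a ∈ Ioc s n | IsFar x (6 * r) a} : Finset ℕ)} →
      Set (Fin (n + 1)) := Sum.elim
    (fun C => {v | ∃ h : (v : ℕ) < s + 1, G.connectedComponentMk ⟨v, h⟩ = C})
    (fun a => {v | (v : ℕ) = a})
  have hfar : ∀ i a : ℕ, i < a → IsFar x (6 * r) a → 6 * r ≤ dist (x i) (x a) :=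
    fun i a hia h => (h i hia).le
  have hmem : ∀ a : {a // a ∈ ({a ∈ Ioc s n | IsFar x (6 * r) a} : Finset ℕ)},
      s < a.1 ∧ a.1 ≤ n ∧ IsFar x (6 * r) a.1 := fun a => by
    have := a.2
    simp only [mem_filter, mem_Ioc] at this
    exact ⟨this.1.1, this.1.2, this.2⟩
  have key := card_le_of_separated (fun i : Fin (n + 1) => x i) (S := {v | (v : ℕ) ≤ s}) (F := F)
    hr (A := A) ?_ ?_ ?_ hF
  · rw [Fintype.card_sum, Fintype.card_coe, ← Nat.card_eq_fintype_card] at key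
    push_cast at key
    exact key
  · rintro (C | a)
    · induction C using SimpleGraph.ConnectedComponent.ind with | _ v =>
      exact ⟨⟨v, by omega⟩, v.2, rfl⟩
    · exact ⟨⟨a, by have := hmem a; omega⟩, rfl⟩
  · rintro (C | a) (C' | a') hne u hu v hv
    · obtain ⟨hu, rfl⟩ := hu
      obtain ⟨hv, rfl⟩ := hv
      exact le_dist_of_connectedComponentMk_ne x (i := ⟨u, hu⟩) (j := ⟨v, hv⟩)
        fun h => hne (by rw [h])
    · obtain ⟨hu, rfl⟩ := hu
      have hv : (v : ℕ) = a' := hv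
      have := hmem a'
      exact hfar _ _ (by omega) (hv ▸ this.2.2)
    · obtain ⟨hv, rfl⟩ := hv
      have hu : (u : ℕ) = a := hu
      have := hmem a
      rw [dist_comm]
      exact hfar _ _ (by omega) (hu ▸ this.2.2)
    · have hu : (u : ℕ) = a := hu
      have hv : (v : ℕ) = a' := hv
      have h1 := hmem a
      have h2 := hmem a'
      rcases lt_trichotomy (u : ℕ) v with h | h | h
      · exact hfar _ _ h (hv ▸ h2.2.2)
      · exact absurd (congrArg Sum.inr (Subtype.ext (hu.symm.trans (h.trans hv)))) hne
      · rw [dist_comm]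
        exact hfar _ _ h (hu ▸ h1.2.2)
  · rintro (C | a) u hu v (hv : (v : ℕ) ≤ s) hvA
    · obtain ⟨hu, rfl⟩ := hu
      exact le_dist_of_connectedComponentMk_ne x (i := ⟨u, hu⟩) (j := ⟨v, Nat.lt_succ_of_le hv⟩)
        fun h => hvA ⟨Nat.lt_succ_of_le hv, h.symm⟩
    · have hu : (u : ℕ) = a := hu
      have := hmem a
      rw [dist_comm]
      exact hfar _ _ (by omega) (hu ▸ this.2.2)

open Classical in
/-- Over all scales, `n - s` arrivals merge only `O(n - s)` of the clusters. -/
theorem sum_numClusters_add_card_isFar_le (x : ℕ → X) {s n : ℕ} (hs : s ≤ n) {ρ : ℝ} (hρ : 0 < ρ)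
    (Q : ℕ) :
    ∑ j ∈ range Q, ((numClusters (prefixLength x s) (ρ * 6 ^ (j + 1)) : ℝ) +
        #{a ∈ Ioc s n | IsFar x (ρ * 6 ^ (j + 1)) a}) ≤
      ∑ j ∈ range Q, (numClusters (prefixLength x n) (ρ * 6 ^ j) : ℝ) + 12 / 5 * (n - s : ℕ) := by
  obtain ⟨H, hH, hF⟩ := exists_connecting_edges x hs
  have hpos : ∀ j : ℕ, 0 < ρ * 6 ^ j := fun j => by positivity
  choose F hF1 hF2 using fun j : ℕ => hF (ρ * 6 ^ j) (hpos j).le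
  have h1 : ∀ j : ℕ, graphCost (fun i : Fin (n + 1) => x i) (F j) ≤
      ∑ e ∈ H, if prefixLength x n e ≤ ρ * 6 ^ j then prefixLength x n e else 0 := by
    intro j
    rw [← sum_filter]
    refine sum_le_sum_of_subset_of_nonneg (fun e he => ?_) fun e _ _ => edgeLength_nonneg _ e
    rw [SimpleGraph.mem_edgeFinset] at he
    exact mem_filter.2 (hF1 j e he)
  -- An edge of `H` is used only at scales no smaller than its length, so its relative lengths form
  -- a geometric series: `2 * (6/5) = 12/5`.
  have h2 : ∑ j ∈ range Q, 2 / (ρ * 6 ^ j) * graphCost (fun i : Fin (n + 1) => x i) (F j) ≤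
      12 / 5 * (n - s : ℕ) := by
    calc _ ≤ ∑ j ∈ range Q, ∑ e ∈ H, 2 * (if prefixLength x n e / ρ / 6 ^ j ≤ 1 then
            prefixLength x n e / ρ / 6 ^ j else 0) := by
          refine sum_le_sum fun j _ => ?_
          refine (mul_le_mul_of_nonneg_left (h1 j) (by have := hpos j; positivity)).trans
            (le_of_eq ?_)
          rw [mul_sum]
          refine sum_congr rfl fun e _ => ?_
          have h3 : prefixLength x n e / ρ / 6 ^ j ≤ 1 ↔ prefixLength x n e ≤ ρ * 6 ^ j := by
            rw [div_div, div_le_one (hpos j)]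
          simp only [h3]
          split_ifs
          · field_simp
          · ring
      _ ≤ ∑ e ∈ H, (12 / 5 : ℝ) := by
          rw [sum_comm]
          refine sum_le_sum fun e _ => ?_
          rw [← mul_sum]
          have h3 := sum_geometric_le (div_nonneg (edgeLength_nonneg _ e) hρ.le :
            0 ≤ prefixLength x n e / ρ) Q
          have := min_le_left 1 (prefixLength x n e / ρ)
          linarith
      _ ≤ 12 / 5 * (n - s : ℕ) := by
          rw [sum_const, nsmul_eq_mul, mul_comm]
          gcongr
  refine le_trans ?_ (add_le_add_right h2 _)
  rw [← sum_add_distrib]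
  refine sum_le_sum fun j _ => ?_
  have h3 : ρ * 6 ^ (j + 1) = 6 * (ρ * 6 ^ j) := by ring
  rw [h3]
  exact numClusters_add_card_isFar_le x hs (hpos j) (hF2 j)

theorem numClusters_pos (x : ℕ → X) (n : ℕ) (r : ℝ) : 1 ≤ numClusters (prefixLength x n) r :=
  Nat.card_pos_iff.2 ⟨⟨SimpleGraph.connectedComponentMk _ 0⟩, inferInstance⟩

theorem numClusters_le_add (x : ℕ → X) {s n : ℕ} (hs : s ≤ n) (r : ℝ) :
    numClusters (prefixLength x n) r ≤ numClusters (prefixLength x s) r + (n - s) := by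
  have h : Nat.card ((lightPart (prefixLength x s) r ⊤).ConnectedComponent ⊕ Fin (n - s)) =
      numClusters (prefixLength x s) r + (n - s) := by
    rw [Nat.card_sum, Nat.card_eq_fintype_card (α := Fin _), Fintype.card_fin, numClusters]
  rw [← h]
  let f : lightPart (prefixLength x s) r ⊤ →g lightPart (prefixLength x n) r ⊤ :=
    { toFun := Fin.castLE (by omega)
      map_rel' := fun {a b} hab => ⟨fun h => hab.1 (Fin.castLE_injective _ h), hab.2⟩ }
  refine Nat.card_le_card_of_surjective (Sum.elim (fun C => C.map f) fun i =>
    SimpleGraph.connectedComponentMk _ ⟨s + 1 + i, by omega⟩) fun C => ?_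
  induction C using SimpleGraph.ConnectedComponent.ind with | _ v =>
  by_cases hv : (v : ℕ) < s + 1
  · exact ⟨Sum.inl (SimpleGraph.connectedComponentMk _ ⟨v, hv⟩), rfl⟩
  · refine ⟨Sum.inr ⟨v - (s + 1), by omega⟩, congrArg _ (Fin.ext ?_)⟩
    simp only
    omega

end Growth

/-! ### Amortizing the swaps since the last settled time -/

section Recourse

variable {X : Type*} [PseudoMetricSpace X]

theorem isSettled_output_zero (x : ℕ → X) (ρ : ℝ) :
    IsSettled (prefixLength x 0) ρ (localSearch.output x 0) := by
  intro r _
  have h1 := (isTree_output_localSearch x 0).numHeavy_add_one (prefixLength x 0) (6 * r)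
  rw [h1]
  have : Subsingleton (Fin (0 + 1)) := inferInstanceAs (Subsingleton (Fin 1))
  exact card_connectedComponent_le_of_imp fun u v h => absurd (Subsingleton.elim u v) h.1

open Classical in
/-- The last time up to `n` at which the tree was settled at the scale `ρ`. -/
noncomputable def lastSettled (x : ℕ → X) (n : ℕ) (ρ : ℝ) : ℕ :=
  Nat.findGreatest (fun t => IsSettled (prefixLength x t) ρ (localSearch.output x t)) n

theorem lastSettled_le (x : ℕ → X) (n : ℕ) (ρ : ℝ) : lastSettled x n ρ ≤ n := by
  classical
  unfold lastSettled
  exact Nat.findGreatest_le n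

theorem isSettled_lastSettled (x : ℕ → X) (n : ℕ) (ρ : ℝ) :
    IsSettled (prefixLength x (lastSettled x n ρ)) ρ
      (localSearch.output x (lastSettled x n ρ)) := by
  classical
  exact Nat.findGreatest_spec (P := fun t => IsSettled (prefixLength x t) ρ
    (localSearch.output x t)) (Nat.zero_le n) (isSettled_output_zero x ρ)

/-- Being settled at a larger scale asks for less. This supplies the monotone times required by
`sum_numClusters_le_graphCost`. -/
theorem lastSettled_mono (x : ℕ → X) (n : ℕ) {ρ ρ' : ℝ} (h : ρ ≤ ρ') :
    lastSettled x n ρ ≤ lastSettled x n ρ' := by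
  classical
  exact Nat.findGreatest_mono_left (fun t ht => IsSettled.mono ht h) n

open Classical in
theorem card_isFar_succ (x : ℕ → X) {s t : ℕ} (hst : s ≤ t) (r : ℝ) :
    #{a ∈ Ioc s (t + 1) | IsFar x r a} =
      #{a ∈ Ioc s t | IsFar x r a} + if IsFar x r (t + 1) then 1 else 0 := by
  have h : Ioc s (t + 1) = insert (t + 1) (Ioc s t) := by
    ext a
    simp only [mem_Ioc, mem_insert]
    omega
  rw [h, filter_insert]
  split_ifs
  · rw [card_insert_of_notMem (by simp)]
  · rfl

open Classical in
theorem numLong_le_add_card (x : ℕ → X) {s t : ℕ} (hst : s ≤ t) (r : ℝ) :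
    numLong x t r ≤ numLong x s r + #{a ∈ Ioc s t | IsFar x r a} := by
  induction t, hst using Nat.le_induction with
  | base => simp
  | succ t hst ih =>
    have h := numLong_succ_le x t r
    rw [card_isFar_succ x hst]
    omega

open Classical in
theorem sum_numLong_add_le (x : ℕ → X) {s n : ℕ} {ρ : ℝ} (hρ : 0 < ρ) {Q : ℕ}
    (hQ : ∀ t ≤ n, ∀ e, prefixLength x t e ≤ ρ * 6 ^ Q)
    (hbusy : ∀ t, s < t → t ≤ n → ¬ IsSettled (prefixLength x t) ρ (localSearch.output x t))
    {t : ℕ} (hst : s ≤ t) (htn : t ≤ n) :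
    ∑ j ∈ range Q, numLong x t (ρ * 6 ^ (j + 1)) + 72 * (t - s) ≤
      ∑ j ∈ range Q, (numLong x s (ρ * 6 ^ (j + 1)) +
        #{a ∈ Ioc s t | IsFar x (ρ * 6 ^ (j + 1)) a}) := by
  induction t, hst using Nat.le_induction with
  | base => simp
  | succ t hst ih =>
    have h1 := sum_numLong_succ_le x t hρ (hQ _ htn) (hbusy _ (by omega) htn)
    have h2 := ih (by omega)
    simp_rw [card_isFar_succ x hst]
    simp only [sum_add_distrib] at h1 h2 ⊢
    omega

/-- The tree is never much worse at the scale `ρ` than when it was last settled. -/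
theorem numLong_le (x : ℕ → X) (n : ℕ) {ρ : ℝ} (hρ : 0 < ρ) :
    (numLong x n (6 * ρ) : ℝ) ≤
      2 * (numClusters (prefixLength x (lastSettled x n ρ)) ρ - 1) := by
  classical
  set s := lastSettled x n ρ with hs
  have hsn : s ≤ n := lastSettled_le x n ρ
  have hset : IsSettled (prefixLength x s) ρ (localSearch.output x s) := isSettled_lastSettled x n ρ
  have hbusy : ∀ t, s < t → t ≤ n →
      ¬ IsSettled (prefixLength x t) ρ (localSearch.output x t) := fun t hst htn =>
    Nat.findGreatest_is_greatest (P := fun t => IsSettled (prefixLength x t) ρ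
      (localSearch.output x t)) hst htn
  obtain ⟨Q, hQ⟩ : ∃ Q : ℕ, ∀ t ≤ n, ∀ e, prefixLength x t e ≤ ρ * 6 ^ Q := by
    have hbdd : ∀ t ≤ n, ∀ e, prefixLength x t e ≤
        ∑ i ∈ range (n + 1), ∑ j ∈ range (n + 1), dist (x i) (x j) := by
      intro t ht e
      induction e with | _ u v =>
      rw [prefixLength_mk]
      refine (single_le_sum (f := fun j => dist (x u) (x j)) (fun _ _ => dist_nonneg)
        (mem_range.2 (show (v : ℕ) < n + 1 by omega))).trans ?_
      exact single_le_sum (f := fun i => ∑ j ∈ range (n + 1), dist (x i) (x j))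
        (fun _ _ => sum_nonneg fun _ _ => dist_nonneg) (mem_range.2 (show (u : ℕ) < n + 1 by omega))
    obtain ⟨Q, hQ⟩ := pow_unbounded_of_one_lt
      ((∑ i ∈ range (n + 1), ∑ j ∈ range (n + 1), dist (x i) (x j)) / ρ) (by norm_num : (1 : ℝ) < 6)
    refine ⟨Q, fun t ht e => (hbdd t ht e).trans ?_⟩
    rw [div_lt_iff₀ hρ] at hQ
    linarith
  have h1 := sum_numLong_add_le x hρ hQ hbusy hsn le_rfl
  have h1' : ∑ j ∈ range Q, (numLong x n (ρ * 6 ^ (j + 1)) : ℝ) + 72 * (n - s : ℕ) ≤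
      ∑ j ∈ range Q, ((numLong x s (ρ * 6 ^ (j + 1)) : ℝ) +
        #{a ∈ Ioc s n | IsFar x (ρ * 6 ^ (j + 1)) a}) := by exact_mod_cast h1
  have h2 := sum_numClusters_add_card_isFar_le x hsn hρ Q
  have h3 : ∑ j ∈ range Q, (numClusters (prefixLength x n) (ρ * 6 ^ (j + 1)) : ℝ) ≤
      ∑ j ∈ range Q, ((numLong x n (ρ * 6 ^ (j + 1)) : ℝ) + 1) := by
    refine sum_le_sum fun j _ => ?_
    exact_mod_cast (isTree_output_localSearch x n).numClusters_le (prefixLength x n) _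
  have h4 : ∑ j ∈ range Q, ((numLong x s (ρ * 6 ^ (j + 1)) : ℝ) + 1) ≤
      ∑ j ∈ range Q, (numClusters (prefixLength x s) (ρ * 6 ^ j) : ℝ) := by
    refine sum_le_sum fun j _ => ?_
    have h := hset (ρ * 6 ^ j) (le_mul_of_one_le_right hρ.le (one_le_pow₀ (by norm_num)))
    have h' : ρ * 6 ^ (j + 1) = 6 * (ρ * 6 ^ j) := by ring
    rw [h']
    exact_mod_cast h
  have h5 := sum_range_sub' (fun j => (numClusters (prefixLength x s) (ρ * 6 ^ j) : ℝ)) Q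
  have h6 := sum_range_sub' (fun j => (numClusters (prefixLength x n) (ρ * 6 ^ j) : ℝ)) Q
  have h7 : (1 : ℝ) ≤ numClusters (prefixLength x s) (ρ * 6 ^ Q) := by
    exact_mod_cast numClusters_pos x s _
  have h8 : (1 : ℝ) ≤ numClusters (prefixLength x n) (ρ * 6 ^ Q) := by
    exact_mod_cast numClusters_pos x n _
  have h9 : (numClusters (prefixLength x n) ρ : ℝ) ≤
      numClusters (prefixLength x s) ρ + (n - s : ℕ) := by
    exact_mod_cast numClusters_le_add x hsn ρ
  have h10 : (numLong x n (6 * ρ) : ℝ) ≤ numLong x s (6 * ρ) + (n - s : ℕ) := by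
    have h := numLong_le_add_card x hsn (6 * ρ)
    have h' : #{a ∈ Ioc s n | IsFar x (6 * ρ) a} ≤ n - s :=
      (card_filter_le _ _).trans (Nat.card_Ioc s n).le
    exact_mod_cast h.trans (Nat.add_le_add_left h' _)
  have h11 : (numLong x s (6 * ρ) : ℝ) + 1 ≤ numClusters (prefixLength x s) ρ := by
    exact_mod_cast hset ρ le_rfl
  simp only [sum_add_distrib, sum_sub_distrib, pow_zero, mul_one] at h1' h2 h3 h4 h5 h6
  -- Telescoping leaves `(72 - 12/5 - 1) * (n - s)` at most twice the number of `ρ`-clusters at time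
  -- `s` less one, with ample slack for `n - s` to be at most that number less one. Then `h10` and
  -- `h11` finish.
  linarith

end Recourse

/-! ### Nested moats bound Steiner trees from below -/

section LowerBound

/-- Term `q` is the length of the part of `[f q, f q + L]` in the band `[β q, β (q + 1)]`. Measured
from `f q`, these parts do not overlap, as the bands move up and `f` moves down; the second bound in
the `min` records how far they reach, for the induction. -/
theorem sum_clamp_le {f β : ℕ → ℝ} (hf : Antitone f) (hβ : Monotone β) {L : ℝ} (hL : 0 ≤ L)
    (Q : ℕ) :
    ∑ q ∈ range Q, (max (β q) (min (f q + L) (β (q + 1))) - max (β q) (min (f q) (β (q + 1)))) ≤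
      min L (max 0 (β Q - f Q)) := by
  induction Q with
  | zero => simp [hL]
  | succ Q ih =>
    rw [sum_range_succ]
    have h1 := hf (Nat.le_succ Q)
    have h2 := hβ (Nat.le_succ Q)
    simp only [Nat.succ_eq_add_one] at h1 h2
    have h3 : max 0 (β (Q + 1) - f Q) ≤ max 0 (β (Q + 1) - f (Q + 1)) :=
      max_le_max le_rfl (by linarith)
    refine le_trans ?_ (min_le_min le_rfl h3)
    refine (add_le_add_left ih _).trans ?_
    generalize f Q = a at *
    generalize β Q = b at *
    generalize β (Q + 1) = c at *
    clear ih h3 hf hβ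
    have h4 := min_le_left (a + L) c
    have h5 := min_le_right (a + L) c
    have h6 := min_le_left L (max 0 (b - a))
    have h7 := min_le_right L (max 0 (b - a))
    rcases le_total a b with hab | hab
    · rw [max_eq_right (by linarith : 0 ≤ b - a)] at h6 h7 ⊢
      have h8 := min_le_left a c
      have h9 := le_max_left b (min a c)
      rcases le_total b (min (a + L) c) with hb | hb
      · rw [max_eq_right hb]
        exact le_min (by linarith) (le_max_of_le_right (by linarith))
      · rw [max_eq_left hb]
        exact le_min (by linarith) (le_max_of_le_right (by linarith))
    · rw [max_eq_left (by linarith : b - a ≤ 0), min_eq_right hL, zero_add]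
      rcases le_total a c with hac | hac
      · rw [min_eq_left hac, max_eq_right hab, max_eq_right (le_min (by linarith) h2)]
        exact le_min (by linarith) (le_max_of_le_right (by linarith))
      · rw [min_eq_right hac, min_eq_right (by linarith), sub_self]
        exact le_min hL (le_max_left _ _)

variable {X : Type*} [PseudoMetricSpace X]

/-- The points that belong to the cluster `C`. -/
def clusterPoints (x : ℕ → X) {s : ℕ} {r : ℝ}
    (C : (lightPart (prefixLength x s) r ⊤).ConnectedComponent) : Set X :=
  (fun i : Fin (s + 1) => x i) '' {i | SimpleGraph.connectedComponentMk _ i = C}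

theorem clusterPoints_nonempty (x : ℕ → X) {s : ℕ} {r : ℝ}
    (C : (lightPart (prefixLength x s) r ⊤).ConnectedComponent) : (clusterPoints x C).Nonempty := by
  induction C using SimpleGraph.ConnectedComponent.ind with | _ v =>
  exact ⟨_, v, rfl, rfl⟩

theorem clusterPoints_subset (x : ℕ → X) {s : ℕ} {r : ℝ}
    (C : (lightPart (prefixLength x s) r ⊤).ConnectedComponent) :
    clusterPoints x C ⊆ x '' Set.Iic s := by
  rintro _ ⟨i, -, rfl⟩
  exact ⟨i, Nat.le_of_lt_succ i.2, rfl⟩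

theorem le_dist_of_clusterPoints (x : ℕ → X) {s : ℕ} {r : ℝ}
    (C C' : (lightPart (prefixLength x s) r ⊤).ConnectedComponent) (h : C ≠ C') :
    ∀ a ∈ clusterPoints x C, ∀ b ∈ clusterPoints x C', r ≤ dist a b := by
  rintro _ ⟨i, rfl, rfl⟩ _ ⟨j, rfl, rfl⟩
  exact le_dist_of_connectedComponentMk_ne x h

/-- Only a cluster within `c` of `u` can contribute; clusters being `2 * c` apart, it is unique and
contains a point nearest to `u`. Its distance from `u` is thus that of the whole point set, which no
longer mentions clusters. -/
theorem sum_clamp_clusterPoints_le (x : ℕ → X) (s : ℕ) {b c : ℝ} (hbc : b ≤ c)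
    [Fintype (lightPart (prefixLength x s) (2 * c) ⊤).ConnectedComponent] (u v : X) :
    ∑ C : (lightPart (prefixLength x s) (2 * c) ⊤).ConnectedComponent,
      max (max b (min (Metric.infDist v (clusterPoints x C)) c) -
        max b (min (Metric.infDist u (clusterPoints x C)) c)) 0 ≤
      max b (min (Metric.infDist u (x '' Set.Iic s) + dist u v) c) -
        max b (min (Metric.infDist u (x '' Set.Iic s)) c) := by
  have hmono : ∀ y z : ℝ, y ≤ z → max b (min y c) ≤ max b (min z c) := fun y z h =>
    max_le_max le_rfl (min_le_min h le_rfl)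
  have hnn := hmono _ _ (le_add_of_nonneg_right dist_nonneg :
    Metric.infDist u (x '' Set.Iic s) ≤ Metric.infDist u (x '' Set.Iic s) + dist u v)
  have hne0 : ∀ C : (lightPart (prefixLength x s) (2 * c) ⊤).ConnectedComponent,
      max (max b (min (Metric.infDist v (clusterPoints x C)) c) -
        max b (min (Metric.infDist u (clusterPoints x C)) c)) 0 ≠ 0 →
      Metric.infDist u (clusterPoints x C) < c := by
    intro C hC
    by_contra! hcon
    refine hC (max_eq_right ?_)
    rw [min_eq_right hcon, max_eq_right hbc, sub_nonpos]
    exact max_le hbc (min_le_right _ _)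
  have huniq : ∀ C C' : (lightPart (prefixLength x s) (2 * c) ⊤).ConnectedComponent,
      Metric.infDist u (clusterPoints x C) < c → Metric.infDist u (clusterPoints x C') < c →
      C = C' := by
    intro C C' h h'
    refine eq_of_infDist_lt (D := 2 * c) (clusterPoints_nonempty x)
      (le_dist_of_clusterPoints x) (y := u) ?_ ?_ <;> linarith
  refine sum_le_of_subsingleton_support (by linarith) (fun C _ => ?_)
    fun C _ C' _ h h' => huniq C C' (hne0 C h) (hne0 C' h')
  by_cases hC : Metric.infDist u (clusterPoints x C) < c
  · have hle : Metric.infDist u (x '' Set.Iic s) ≤ Metric.infDist u (clusterPoints x C) :=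
      Metric.infDist_le_infDist_of_subset (clusterPoints_subset x C) (clusterPoints_nonempty x C)
    obtain ⟨_, ⟨i, hi, rfl⟩, hxi⟩ := ((Set.finite_Iic s).image x).isCompact.exists_infDist_eq_dist
      ⟨x 0, 0, Nat.zero_le s, rfl⟩ u
    have hle' : Metric.infDist u (clusterPoints x (SimpleGraph.connectedComponentMk
        (lightPart (prefixLength x s) (2 * c) ⊤) ⟨i, Nat.lt_succ_of_le hi⟩)) ≤
        Metric.infDist u (x '' Set.Iic s) := by
      rw [hxi]
      exact Metric.infDist_le_dist_of_mem ⟨⟨i, Nat.lt_succ_of_le hi⟩, rfl, rfl⟩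
    have heq : Metric.infDist u (clusterPoints x C) = Metric.infDist u (x '' Set.Iic s) := by
      refine le_antisymm ?_ hle
      rw [huniq C _ hC (hle'.trans_lt (hle.trans_lt hC))]
      exact hle'
    rw [heq]
    refine max_le (sub_le_sub_right (hmono _ _ ?_) _) (by linarith)
    rw [← heq, dist_comm]
    exact Metric.infDist_le_infDist_add_dist
  · by_contra! hcon
    exact hC (hne0 C (by linarith))

/-- A tree through all the points pays for moats around the clusters at all scales at once, if at
the larger scales there are at least as many points to be clustered. -/
theorem sum_numClusters_le_graphCost (x : ℕ → X) {n : ℕ} {t : ℕ → ℕ} (ht : Monotone t)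
    (htn : ∀ q, t q ≤ n) {β : ℕ → ℝ} (hβ : Monotone β) (hβ0 : 0 ≤ β 0) (Q : ℕ) {V : Type*}
    [Fintype V] (p : V → X) (hp : ∀ i ≤ n, ∃ v, p v = x i) {G : SimpleGraph V}
    (hG : G.Connected) :
    ∑ q ∈ range Q, (β (q + 1) - β q) *
      ((numClusters (prefixLength x (t q)) (2 * β (q + 1)) : ℝ) - 1) ≤ 2 * graphCost p G := by
  have := fun q => Fintype.ofFinite
    (lightPart (prefixLength x (t q)) (2 * β (q + 1)) ⊤).ConnectedComponent
  let h : (Σ q, (lightPart (prefixLength x (t q)) (2 * β (q + 1)) ⊤).ConnectedComponent) →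
      X → ℝ := fun k y => max (β k.1) (min (Metric.infDist y (clusterPoints x k.2)) (β (k.1 + 1)))
  have hlow : ∀ q, (β (q + 1) - β q) *
      ((numClusters (prefixLength x (t q)) (2 * β (q + 1)) : ℝ) - 1) ≤
      ∑ C, graphCost (fun v => h ⟨q, C⟩ (p v)) G := by
    intro q
    have hq : 0 ≤ β q := hβ0.trans (hβ (Nat.zero_le q))
    have hq' : β q ≤ β (q + 1) := hβ (Nat.le_succ q)
    have hcard : numClusters (prefixLength x (t q)) (2 * β (q + 1)) =
      Fintype.card (lightPart (prefixLength x (t q)) (2 * β (q + 1)) ⊤).ConnectedComponent :=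
        Nat.card_eq_fintype_card
    rcases subsingleton_or_nontrivial
      (lightPart (prefixLength x (t q)) (2 * β (q + 1)) ⊤).ConnectedComponent with hs | hs
    -- A single cluster has no outside point to force a crossing; the `- 1` in the bound covers this
    -- case.
    · have h1 : (numClusters (prefixLength x (t q)) (2 * β (q + 1)) : ℝ) ≤ 1 := by
        rw [hcard]
        exact_mod_cast Fintype.card_le_one_iff_subsingleton.2 hs
      refine le_trans ?_ (sum_nonneg fun C _ => graphCost_nonneg _ G)
      exact mul_nonpos_of_nonneg_of_nonpos (by linarith) (by linarith)
    · have h1 : ∀ C, β (q + 1) - β q ≤ graphCost (fun v => h ⟨q, C⟩ (p v)) G := by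
        intro C
        obtain ⟨C', hC'⟩ := exists_ne C
        obtain ⟨a, ha⟩ := clusterPoints_nonempty x C
        obtain ⟨b, hb⟩ := clusterPoints_nonempty x C'
        obtain ⟨i, hi, hia⟩ := clusterPoints_subset x C ha
        obtain ⟨j, hj, hjb⟩ := clusterPoints_subset x C' hb
        obtain ⟨v, hv⟩ := hp i (le_trans hi (htn q))
        obtain ⟨w, hw⟩ := hp j (le_trans hj (htn q))
        have h2 := dist_le_graphCost (fun v => h ⟨q, C⟩ (p v)) (hG.preconnected v w)
        have h3 : h ⟨q, C⟩ (p v) = β q := by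
          simp only [h]
          rw [hv, hia, Metric.infDist_zero_of_mem ha, min_eq_left (hq.trans hq'), max_eq_left hq]
        have h4 : h ⟨q, C⟩ (p w) = β (q + 1) := by
          have h5 : 2 * β (q + 1) ≤ Metric.infDist b (clusterPoints x C) :=
            (Metric.le_infDist ⟨a, ha⟩).2 fun _ hy => le_dist_of_clusterPoints x C' C hC' b hb _ hy
          simp only [h]
          rw [hw, hjb, min_eq_right (by linarith), max_eq_right hq']
        have h5 := neg_le_abs (h ⟨q, C⟩ (p v) - h ⟨q, C⟩ (p w))
        rw [Real.dist_eq] at h2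
        rw [h3, h4] at h5 h2
        linarith
      calc _ ≤ (β (q + 1) - β q) *
            Fintype.card (lightPart (prefixLength x (t q)) (2 * β (q + 1)) ⊤).ConnectedComponent := by
            rw [hcard]
            exact mul_le_mul_of_nonneg_left (by linarith) (by linarith)
        _ = ∑ C : (lightPart (prefixLength x (t q)) (2 * β (q + 1)) ⊤).ConnectedComponent,
            (β (q + 1) - β q) := by
            rw [sum_const, card_univ, nsmul_eq_mul, mul_comm]
        _ ≤ _ := sum_le_sum fun C _ => h1 C
  refine (sum_le_sum fun q _ => hlow q).trans ?_
  rw [sum_sigma']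
  refine sum_graphCost_le _ p (fun k v => h k (p v)) (fun u v => ?_) G
  rw [sum_sigma]
  have key : ∀ y z : X, ∑ q ∈ range Q, ∑ C, max (h ⟨q, C⟩ z - h ⟨q, C⟩ y) 0 ≤ dist y z := by
    intro y z
    refine (sum_le_sum fun q _ =>
      sum_clamp_clusterPoints_le x (t q) (hβ (Nat.le_succ q)) y z).trans ?_
    refine (sum_clamp_le (f := fun q => Metric.infDist y (x '' Set.Iic (t q))) ?_ hβ
      -- Later times have more points, so the distance to the point set decreases in `q`, as
      -- `sum_clamp_le` requires.
      dist_nonneg Q).trans (min_le_left _ _)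
    intro q q' hqq'
    exact Metric.infDist_le_infDist_of_subset (Set.image_mono (Set.Iic_subset_Iic.2 (ht hqq')))
      ⟨x 0, 0, Nat.zero_le _, rfl⟩
  have h1 := key (p u) (p v)
  have h2 := key (p v) (p u)
  rw [dist_comm (p v)] at h2
  calc _ ≤ ∑ q ∈ range Q, ∑ C, (max (h ⟨q, C⟩ (p v) - h ⟨q, C⟩ (p u)) 0 +
        max (h ⟨q, C⟩ (p u) - h ⟨q, C⟩ (p v)) 0) := by
        refine sum_le_sum fun q _ => sum_le_sum fun C _ => ?_
        rw [Real.dist_eq, abs_le']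
        have := le_max_left (h ⟨q, C⟩ (p v) - h ⟨q, C⟩ (p u)) 0
        have := le_max_right (h ⟨q, C⟩ (p v) - h ⟨q, C⟩ (p u)) 0
        have := le_max_left (h ⟨q, C⟩ (p u) - h ⟨q, C⟩ (p v)) 0
        have := le_max_right (h ⟨q, C⟩ (p u) - h ⟨q, C⟩ (p v)) 0
        constructor <;> linarith
    _ ≤ _ := by
        simp only [sum_add_distrib]
        linarith

end LowerBound

/-! ### Comparing the maintained tree with the optimum -/

section Cost

variable {X : Type*} [PseudoMetricSpace X]

theorem min_le_add_sum_scales (σ L : ℝ) (Q : ℕ) :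
    min L (σ * 6 ^ (Q + 1)) ≤ 6 * σ + ∑ q ∈ range Q,
      if σ * 6 ^ (q + 1) < L then σ * 6 ^ (q + 2) - σ * 6 ^ (q + 1) else 0 := by
  induction Q with
  | zero =>
    rw [range_zero, sum_empty, zero_add, pow_one]
    exact (min_le_right _ _).trans (by linarith)
  | succ Q ih =>
    rw [sum_range_succ]
    split_ifs with h
    · rw [min_eq_right h.le] at ih
      have := min_le_right L (σ * 6 ^ (Q + 1 + 1))
      linarith
    · rw [min_eq_left (not_lt.1 h)] at ih
      have := min_le_left L (σ * 6 ^ (Q + 1 + 1))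
      linarith

open Classical in
theorem graphCost_le_sum_numHeavy {V : Type*} [Fintype V] (p : V → X) {G : SimpleGraph V} {σ : ℝ}
    {Q : ℕ} (hQ : ∀ e, edgeLength p e ≤ σ * 6 ^ (Q + 1)) :
    graphCost p G ≤ #G.edgeFinset * (6 * σ) + ∑ q ∈ range Q,
      (σ * 6 ^ (q + 2) - σ * 6 ^ (q + 1)) * numHeavy (edgeLength p) (σ * 6 ^ (q + 1)) G := by
  have h1 : graphCost p G ≤ ∑ e ∈ G.edgeFinset, (6 * σ + ∑ q ∈ range Q,
      if σ * 6 ^ (q + 1) < edgeLength p e then σ * 6 ^ (q + 2) - σ * 6 ^ (q + 1) else 0) := by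
    refine sum_le_sum fun e _ => ?_
    have := min_le_add_sum_scales σ (edgeLength p e) Q
    rwa [min_eq_left (hQ e)] at this
  refine h1.trans (le_of_eq ?_)
  rw [sum_add_distrib, sum_const, nsmul_eq_mul, sum_comm]
  congr 1
  refine sum_congr rfl fun q _ => ?_
  rw [← sum_filter, sum_const, nsmul_eq_mul, mul_comm, numHeavy]
  congr 3
  ext e
  simp

theorem graphCost_output_le (x : ℕ → X) (n : ℕ) {V : Type*} [Fintype V] (p : V → X)
    (hp : ∀ i ≤ n, ∃ v, p v = x i) {G : SimpleGraph V} (hG : G.Connected) :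
    graphCost (fun i : Fin (n + 1) => x i) (localSearch.output x n) ≤ 288 * graphCost p G := by
  classical
  set N := #(localSearch.output x n).edgeFinset
  have key : ∀ σ : ℝ, 0 < σ → graphCost (fun i : Fin (n + 1) => x i) (localSearch.output x n) ≤
      N * (6 * σ) + 288 * graphCost p G := by
    intro σ hσ
    obtain ⟨Q, hQ⟩ : ∃ Q : ℕ, ∀ e, prefixLength x n e ≤ σ * 6 ^ (Q + 1) := by
      obtain ⟨M, hM⟩ := (Set.finite_range (prefixLength x n)).bddAbove
      obtain ⟨Q, hQ⟩ := pow_unbounded_of_one_lt (M / σ) (by norm_num : (1 : ℝ) < 6)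
      refine ⟨Q, fun e => (hM ⟨e, rfl⟩).trans ?_⟩
      rw [div_lt_iff₀ hσ] at hQ
      have : 0 < σ * 6 ^ Q := by positivity
      rw [pow_succ]
      linarith
    refine (graphCost_le_sum_numHeavy _ hQ).trans ?_
    -- The divisor 12 makes `2 * β (q + 1)` equal to `σ * 6 ^ q`, the scale in `numLong_le`.
    have hlow := sum_numClusters_le_graphCost x (n := n)
      (t := fun q => lastSettled x n (σ * 6 ^ q)) (β := fun q => σ * 6 ^ q / 12)
      (fun q q' h => lastSettled_mono x n
        (mul_le_mul_of_nonneg_left (pow_le_pow_right₀ (by norm_num) h) hσ.le))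
      (fun q => lastSettled_le x n _)
      (fun q q' h => div_le_div_of_nonneg_right
        (mul_le_mul_of_nonneg_left (pow_le_pow_right₀ (by norm_num) h) hσ.le) (by norm_num))
      (by positivity) Q p hp hG
    -- The length band is 72 times as wide as the moat, and `numLong_le` loses a factor 2; the 2 of
    -- `hlow` then turns 144 into 288.
    have hterm : ∑ q ∈ range Q, (σ * 6 ^ (q + 2) - σ * 6 ^ (q + 1)) *
        (numHeavy (edgeLength fun i : Fin (n + 1) => x i) (σ * 6 ^ (q + 1))
          (localSearch.output x n) : ℝ) ≤
        144 * ∑ q ∈ range Q, (σ * 6 ^ (q + 1) / 12 - σ * 6 ^ q / 12) *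
          ((numClusters (prefixLength x (lastSettled x n (σ * 6 ^ q)))
            (2 * (σ * 6 ^ (q + 1) / 12)) : ℝ) - 1) := by
      rw [mul_sum]
      refine sum_le_sum fun q _ => ?_
      have hpos : 0 < σ * 6 ^ q := by positivity
      have h1 := numLong_le x n hpos
      have h2 : 2 * (σ * 6 ^ (q + 1) / 12) = σ * 6 ^ q := by ring
      have h3 : σ * 6 ^ (q + 1) = 6 * (σ * 6 ^ q) := by ring
      rw [h2, show σ * 6 ^ (q + 2) = 36 * (σ * 6 ^ q) by ring, h3]
      have h4 : (numHeavy (edgeLength fun i : Fin (n + 1) => x i) (6 * (σ * 6 ^ q))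
          (localSearch.output x n) : ℝ) = numLong x n (6 * (σ * 6 ^ q)) := rfl
      rw [h4]
      have h5 := mul_le_mul_of_nonneg_left h1 hpos.le
      linarith
    linarith
  -- Letting `σ` tend to 0 removes the contribution of the short edges.
  refine le_of_forall_pos_le_add fun ε hε => ?_
  have hN : (0 : ℝ) < 6 * (N + 1) := by positivity
  have h := key (ε / (6 * (N + 1))) (by positivity)
  have h' : N * (6 * (ε / (6 * (N + 1)))) ≤ ε := by
    rw [← mul_assoc, mul_div_assoc', div_le_iff₀ hN]
    nlinarith
  linarith

theorem steinerOpt_nonneg (S : Set X) : 0 ≤ steinerOpt S :=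
  Real.sInf_nonneg fun _ ⟨_, _, _, _, hc⟩ => hc ▸ graphCost_nonneg _ _

theorem graphCost_output_le_steinerOpt (x : ℕ → X) (n : ℕ) :
    graphCost (fun i : Fin (n + 1) => x i) (localSearch.output x n) ≤
      288 * steinerOpt (x '' Set.Iic n) := by
  classical
  rw [mul_comm, ← div_le_iff₀ (by norm_num : (0 : ℝ) < 288)]
  refine le_csInf ?_ ?_
  · have : Nonempty ((Finset.Iic n).image x) :=
      ⟨⟨x 0, mem_image_of_mem x (mem_Iic.2 (Nat.zero_le n))⟩⟩
    obtain ⟨T, -, hT⟩ :=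
      (SimpleGraph.connected_top (V := ((Finset.Iic n).image x))).exists_isTree_le
    exact ⟨_, (Finset.Iic n).image x, T, by simp, hT, rfl⟩
  · rintro _ ⟨V, G, hV, hG, rfl⟩
    rw [div_le_iff₀ (by norm_num), mul_comm]
    exact graphCost_output_le x n _
      (fun i hi => ⟨⟨x i, hV (Set.mem_image_of_mem x hi)⟩, rfl⟩) hG.connected

end Cost

theorem theorem3 (α : ℝ) (hα : 6 ≤ α) :
    ∃ A : OnlineAlgorithm, ∀ (X : Type*) [PseudoMetricSpace X] (x : ℕ → X) (n : ℕ),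
      -- `T_n` is a spanning tree of the points that have arrived
      (A.output x n).IsTree ∧
      -- its cost is within the claimed factor of the optimal Steiner tree
      graphCost (fun i : Fin (n + 1) => x i) (A.output x n)
        ≤ 2 * α ^ 5 / (α - 1) ^ 2 * steinerOpt (x '' Set.Iic n) ∧
      -- on the next arrival: one edge to the new vertex, and then at most `2 α ^ 2` swaps
      ∃ (u : Fin (n + 1)) (k : ℕ), (k : ℝ) ≤ 2 * α ^ 2 ∧
        SwapsTo k (addLeaf (A.output x n) u) (A.output x (n + 1)) := by
  refine ⟨localSearch, fun X _ x n => ⟨isTree_output_localSearch x n, ?_, ?_⟩⟩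
  · refine (graphCost_output_le_steinerOpt x n).trans
      (mul_le_mul_of_nonneg_right ?_ (steinerOpt_nonneg _))
    have h1 : 0 < α - 1 := by linarith
    rw [le_div_iff₀ (by positivity)]
    have h2 : (216 : ℝ) ≤ α ^ 3 := by
      have := pow_le_pow_left₀ (by norm_num) hα 3
      norm_num at this
      exact this
    have h3 : (α - 1) ^ 2 ≤ α ^ 2 := pow_le_pow_left₀ h1.le (by linarith) 2
    calc 288 * (α - 1) ^ 2 ≤ 2 * 216 * α ^ 2 := by nlinarith [sq_nonneg α]
      _ ≤ 2 * α ^ 3 * α ^ 2 := by gcongr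
      _ = 2 * α ^ 5 := by ring
  · obtain ⟨u, k, hk, h⟩ := swapsTo_output_localSearch x n
    refine ⟨u, k, ?_, h⟩
    have h1 : (k : ℝ) ≤ 72 := by exact_mod_cast hk
    nlinarith
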